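/- Let $\rho_L,\rho_H,\lambda,c,r>0$ and $\bar y\in(0,1)$. A hidden state switches from low to high at rate $\rho_L$ and from high to low at rate $\rho_H$; its stationary probability of being high is $\pi_0=\rho_L/(\rho_L+\rho_H)$. In the high state crime opportunities arrive at rate $\lambda$, and each leads to a crime with probability $x\in[0,1]$ (the crime level); in the low state there are none. At belief $p$ (probability of the high state) and enforcement level $y\in[0,1]$ the flow loss of the policymaker (PM) is $\ell_x(p,y)=p\lambda x(1-y)+cy$; losses are discounted at rate $r$. Criminals do not observe past crime data; a crime level $x\in[0,1]$ is a best response to an expected enforcement level $e$ if $x=0$ when $e>\bar y$ and $x=1$ when $e<\bar y$ (any $x\in[0,1]$ when $e=\bar y$). Non-predictive enforcement (NP): the PM's belief is always $\pi_0$. An NP equilibrium is a pair $(x,y)\in[0,1]^2$ such that $y$ minimizes $\ell_x(\pi_0,\cdot)$ on $[0,1]$ and $x$ is a best response to $y$. The PM's expected loss is $\int_0^\infty \ell_x(\pi_0,y)e^{-rt}\,dt$. Greedy predictive enforcement (GP): the PM uses a policy $y:[0,1]\to[0,1]$ of her belief $p_t$. The belief jumps to $1$ when a crime is detected, which happens at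 rate $p_t\lambda x\,y(p_t)$, and otherwise follows $\dot p=\rho_L(1-p)-\rho_Hp-p(1-p)\lambda x\,y(p)=:f(p,y(p))$; the policy is admissible if this differential equation has exactly one solution (in the integrated sense, with values in $[0,1]$, for all $t\ge 0$) from every initial belief in $[0,1]$. A GP equilibrium is a pair $(x,y(\cdot))$ such that $y(\cdot)$ is admissible, $y(p)$ minimizes $\ell_x(p,\cdot)$ on $[0,1]$ for every $p\in[0,1]$, and $x$ is a best response to the expected enforcement conditional on the high state, $\int y(p)\,\frac{p}{\pi_0}\,d\Phi(p)$, where $\Phi$ is a stationary distribution of the belief process. The PM's expected loss from the initial belief $p_0$ is $\mathbb E\big[\int_0^\infty \ell_x(p_t,y(p_t))e^{-rt}\,dt\,\big|\,p_0\big]$. The long-run priors are: only $\pi_0$ if $\lambda x\pi_0\le c$; otherwise all $p_0\in[0,1]$ with $p_0\ge c/(\lambda x)$ and $p_0\ge\pi_1$, where $\pi_1\in(0,1)$ is defined by $f(\pi_1,1)=0$. Then an NP equilibrium exists, a GP equilibrium exists, and for every NP equilibrium, every GP equilibrium and every long-run prior $p_0$ of the latter, the PM's expected loss in the GP equilibrium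 from $p_0$ equals her expected loss in the NP equilibrium. -/

import Mathlib

open MeasureTheory ProbabilityTheory Set
open scoped ENNReal

noncomputable section

namespace PredictiveEnforcement

/-- The primitives of the enforcement model with endogenous crime. -/
structure Model where
  /-- switching rate of the hidden state from low to high -/
  rhoL : ℝ
  /-- switching rate of the hidden state from high to low -/
  rhoH : ℝ
  /-- arrival rate of crime opportunities in the high state -/
  lam : ℝ
  /-- unit cost of enforcement -/
  c : ℝ
  /-- discount rate -/
  r : ℝ
  /-- deterrence threshold of the criminals -/
  ybar : ℝ
  rhoL_pos : 0 < rhoL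
  rhoH_pos : 0 < rhoH
  lam_pos : 0 < lam
  c_pos : 0 < c
  r_pos : 0 < r
  ybar_pos : 0 < ybar
  ybar_lt_one : ybar < 1

/-- The stationary probability of the high state. -/
def Model.pi0 (M : Model) : ℝ := M.rhoL / (M.rhoH + M.rhoL)

/-- The flow loss of the policymaker at belief `p` and enforcement level `y`, when the crime level
is `x`: expected unmitigated harm plus enforcement cost. -/
def Model.flowLoss (M : Model) (x p y : ℝ) : ℝ := p * M.lam * x * (1 - y) + M.c * y

/-- The time derivative of the belief while no crime is detected. -/
def Model.drift (M : Model) (x p y : ℝ) : ℝ :=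
  M.rhoL * (1 - p) - M.rhoH * p - p * (1 - p) * M.lam * x * y

/-- The rate at which crimes are detected at belief `p` and enforcement level `y`. -/
def Model.detectionRate (M : Model) (x p y : ℝ) : ℝ := p * M.lam * x * y

/-! ### The belief process under a Markovian policy

A policy is a function `y : ℝ → ℝ` of the belief; only its values on `[0, 1]` matter. -/

/-- `φ` is a trajectory, from initial belief `p`, of the belief in the absence of detections under
the policy `y`: a solution of `φ' = f (φ, y (φ))`, `φ 0 = p`, in integrated form. -/
def Model.IsBeliefPath (M : Model) (x : ℝ) (y : ℝ → ℝ) (p : ℝ) (φ : ℝ → ℝ) : Prop :=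
  ContinuousOn φ (Ici 0) ∧
    ∀ t : ℝ, 0 ≤ t →
      φ t ∈ Icc (0 : ℝ) 1 ∧
      IntervalIntegrable (fun s => M.drift x (φ s) (y (φ s))) volume 0 t ∧
      φ t = p + ∫ s in (0 : ℝ)..t, M.drift x (φ s) (y (φ s))

/-- Admissibility: under the policy the belief dynamics is well defined, i.e. from every initial
belief there is one and only one trajectory of the belief without detections. In particular, a
belief that attracts drifts from above and from below has to be a stationary point. -/
def Model.Admissible (M : Model) (x : ℝ) (y : ℝ → ℝ) : Prop :=
  ∀ p ∈ Icc (0 : ℝ) 1, ∃ φ : ℝ → ℝ, M.IsBeliefPath x y p φ ∧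
    ∀ ψ : ℝ → ℝ, M.IsBeliefPath x y p ψ → EqOn ψ φ (Ici 0)

open Classical in
/-- The trajectory of the belief from `p` in the absence of detections
(constant if there is none, which an admissible policy excludes). -/
def Model.beliefPath (M : Model) (x : ℝ) (y : ℝ → ℝ) (p : ℝ) : ℝ → ℝ :=
  if h : ∃ φ : ℝ → ℝ, M.IsBeliefPath x y p φ then h.choose else fun _ => p

/-- The detection rate accumulated up to time `t` along the trajectory from `p`. -/
def Model.cumulativeRate (M : Model) (x : ℝ) (y : ℝ → ℝ) (p t : ℝ) : ℝ :=
  ∫ s in (0 : ℝ)..t,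
    M.detectionRate x (M.beliefPath x y p s) (y (M.beliefPath x y p s))

/-- The waiting time until the next detection from belief `p`: the first time at which the
accumulated detection rate reaches the threshold `e` (infinite if this never happens). With `e`
exponentially distributed with mean one, no detection occurs up to time `t` with probability
`exp (- cumulativeRate p t)`. -/
def Model.waitingTime (M : Model) (x : ℝ) (y : ℝ → ℝ) (p e : ℝ) : ℝ≥0∞ :=
  ⨅ (t : ℝ) (_ : 0 ≤ t ∧ e ≤ M.cumulativeRate x y p t), ENNReal.ofReal t

/-- The sample space: sequences of thresholds. -/
abbrev Sample : Type := ℕ → ℝ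

instance instIsProbabilityMeasureExpMeasureOne : IsProbabilityMeasure (expMeasure 1) :=
  isProbabilityMeasure_expMeasure one_pos

/-- The thresholds are independent and exponentially distributed with mean one. -/
def sampleMeasure : Measure Sample := Measure.infinitePi fun _ : ℕ => expMeasure 1

/-- The time of the `n`-th detection (counted from zero) when the initial belief is `p`. After
each detection the belief restarts from one. -/
def Model.detectionTime (M : Model) (x : ℝ) (y : ℝ → ℝ) (p : ℝ) (ω : Sample) : ℕ → ℝ≥0∞
  | 0 => M.waitingTime x y p (ω 0)
  | n + 1 => M.detectionTime x y p ω n + M.waitingTime x y 1 (ω (n + 1))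

open Classical in
/-- The time of the last detection up to time `t` (zero if there is none). -/
def Model.lastDetection (M : Model) (x : ℝ) (y : ℝ → ℝ) (p : ℝ) (ω : Sample) (t : ℝ) : ℝ :=
  (⨆ n : ℕ, if M.detectionTime x y p ω n ≤ ENNReal.ofReal t
    then M.detectionTime x y p ω n else 0).toReal

open Classical in
/-- The policymaker's belief at time `t ≥ 0` when the initial belief is `p`: it follows the
detection-free trajectory from `p` before the first detection, jumps to one at every detection,
and follows the detection-free trajectory from one afterwards. -/
def Model.belief (M : Model) (x : ℝ) (y : ℝ → ℝ) (p t : ℝ) (ω : Sample) : ℝ :=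
  if M.detectionTime x y p ω 0 ≤ ENNReal.ofReal t then
    M.beliefPath x y 1 (t - M.lastDetection x y p ω t)
  else M.beliefPath x y p t

/-- The expected total discounted loss of the policymaker who follows the policy `y` from the
initial belief `p`, when the crime level is `x`. -/
def Model.expectedLoss (M : Model) (x : ℝ) (y : ℝ → ℝ) (p : ℝ) : ℝ :=
  ∫ ω, (∫ t in Ioi (0 : ℝ),
    M.flowLoss x (M.belief x y p t ω) (y (M.belief x y p t ω)) * Real.exp (-M.r * t))
    ∂sampleMeasure

/-! ### Best responses and equilibria -/

/-- The enforcement level `y` minimizes the flow loss at belief `p`. -/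
def Model.IsMyopicOptimum (M : Model) (x p y : ℝ) : Prop :=
  y ∈ Icc (0 : ℝ) 1 ∧ ∀ y' ∈ Icc (0 : ℝ) 1, M.flowLoss x p y ≤ M.flowLoss x p y'

/-- The crime level `x` is a best response of the criminals to the expected enforcement `e`. -/
def Model.IsCrimeResponse (M : Model) (e x : ℝ) : Prop :=
  x ∈ Icc (0 : ℝ) 1 ∧ (M.ybar < e → x = 0) ∧ (e < M.ybar → x = 1)

/-- Equilibrium under non-predictive enforcement: the policymaker holds the constant belief `pi0`,
and the enforcement level `y` and the crime level `x` are mutual best responses. -/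
def Model.IsNPEquilibrium (M : Model) (x y : ℝ) : Prop :=
  M.IsMyopicOptimum x M.pi0 y ∧ M.IsCrimeResponse y x

/-- The expected total discounted loss under non-predictive enforcement. -/
def Model.lossNP (M : Model) (x y : ℝ) : ℝ :=
  ∫ t in Ioi (0 : ℝ), M.flowLoss x M.pi0 y * Real.exp (-M.r * t)

/-- `Φ` is a stationary distribution of the belief process under the policy `y`: if the initial
belief has law `Φ`, then so has the belief at every later time. -/
def Model.IsStationary (M : Model) (x : ℝ) (y : ℝ → ℝ) (Φ : Measure ℝ) : Prop :=
  IsProbabilityMeasure Φ ∧ Φ (Icc (0 : ℝ) 1)ᶜ = 0 ∧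
    ∀ t : ℝ, 0 ≤ t → ∀ B : Set ℝ, MeasurableSet B →
      ∫⁻ p, sampleMeasure {ω | M.belief x y p t ω ∈ B} ∂Φ = Φ B

/-- The long-run distribution of the belief conditional on the high state: as the belief `p` is
the probability of the high state, it has density `p / pi0` with respect to the unconditional
long-run distribution. -/
def Model.conditionalOnHigh (M : Model) (Φ : Measure ℝ) : Measure ℝ :=
  Φ.withDensity fun p => ENNReal.ofReal (p / M.pi0)

/-- Equilibrium under greedy predictive enforcement with non-predictive criminals: the policy `y`
is admissible and myopically optimal at every belief, given the crime level `x`, and the constant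
crime level `x` is a best response to the expected enforcement conditional on the high state. -/
def Model.IsGPEquilibrium (M : Model) (x : ℝ) (y : ℝ → ℝ) : Prop :=
  M.Admissible x y ∧
  (∀ p ∈ Icc (0 : ℝ) 1, M.IsMyopicOptimum x p (y p)) ∧
  ∃ Φ : Measure ℝ, M.IsStationary x y Φ ∧
    M.IsCrimeResponse (∫ p, y p ∂(M.conditionalOnHigh Φ)) x

/-- The long-run priors under greedy predictive enforcement with crime level `x`, where the myopic
cutoff is `c / (lam * x)`: only `pi0` if the cutoff is at least `pi0`; otherwise all beliefs in
`[0, 1]` that are at least the cutoff and at least `pi1`, the root of the drift under full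
enforcement (on `[0, 1]`, the drift under full enforcement is nonpositive exactly from `pi1` on). -/
def Model.longRunPriors (M : Model) (x : ℝ) : Set ℝ :=
  {p | if M.lam * x * M.pi0 ≤ M.c then p = M.pi0
    else p ∈ Icc (0 : ℝ) 1 ∧ M.c ≤ M.lam * x * p ∧ M.drift x p 1 ≤ 0}

end PredictiveEnforcement

end

namespace PredictiveEnforcement

variable {M : Model} {x : ℝ} {y : ℝ → ℝ}

/-! Both losses equal `min (λ π₀) c / r`. The starting point is that a myopic optimum at belief `p`
has flow loss `min (λ x p) c` (`IsMyopicOptimum.flowLoss_eq`), whatever is chosen at a tie. So it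
suffices to know on which side of the cutoff `c / (λ x)` the belief lies, and which `x` is
compatible with the criminals' incentives.

Non-predictive case (`lossNP_eq`): the cutoff cannot lie below `π₀`, for full enforcement would
deter all crime. If it lies above, there is no enforcement, so `x = 1`; if it equals `π₀`, the loss
rate is `c`, and `c ≤ λ π₀`.

Greedy case (`expectedLoss_eq`): if the cutoff is at least `π₀`, the belief started at `π₀` never
moves. If it is strictly above `π₀`, enforcement dies out in every stationary law
(`stationary_enforced_eq_zero`), hence again `x = 1`. If the cutoff is below `π₀`, a belief at or
above it never falls below it, because the drift without enforcement points up to `π₀`; the flow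
loss is then `c` on every sample path.

Existence of a greedy equilibrium is the longer half. If `λ π₀ ≤ c`, full crime with the point mass
at `π₀` works. Otherwise the candidates are indexed by the cutoff `q`, with `x = c / (λ q)` and, at
`q`, the enforcement `Y` that makes `q` a rest point. From one, the belief follows a Riccati
equation down to `q` in finite time and rests there until the next detection. Detections thus form a
renewal process whose age determines the belief, and the equilibrium age law, with density
proportional to `exp (-H)`, pushes forward to a stationary law (`IsHazard.lintegral_age`,
`IsRegeneration.isStationary`). The resulting expected enforcement `E` satisfies `E (Y + s (1 - Y))
= Y`, where `s` is the probability of reaching `q` undetected (`exists_isStationary_cutoffPolicy`).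
The intermediate value theorem in `q` then gives `E = ybar`, unless the corner `x = 1` with `E ≤
ybar` is already an equilibrium. -/

lemma Model.switch_pos (M : Model) : 0 < M.rhoH + M.rhoL := add_pos M.rhoH_pos M.rhoL_pos

lemma Model.pi0_pos (M : Model) : 0 < M.pi0 := div_pos M.rhoL_pos M.switch_pos

lemma Model.pi0_lt_one (M : Model) : M.pi0 < 1 := by
  rw [Model.pi0, div_lt_one M.switch_pos]
  linarith [M.rhoH_pos]

lemma Model.pi0_mem (M : Model) : M.pi0 ∈ Icc (0 : ℝ) 1 := ⟨M.pi0_pos.le, M.pi0_lt_one.le⟩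

lemma Model.switch_mul_pi0 (M : Model) : (M.rhoH + M.rhoL) * M.pi0 = M.rhoL :=
  mul_div_cancel₀ _ M.switch_pos.ne'

lemma Model.drift_eq (M : Model) (x p y : ℝ) :
    M.drift x p y = (M.rhoH + M.rhoL) * (M.pi0 - p) - p * (1 - p) * (M.lam * x) * y := by
  rw [mul_sub, M.switch_mul_pi0, Model.drift]
  ring

lemma Model.drift_le (M : Model) {x p y : ℝ} (hx : 0 ≤ x) (hp : p ∈ Icc (0 : ℝ) 1) (hy : 0 ≤ y) :
    M.drift x p y ≤ (M.rhoH + M.rhoL) * (M.pi0 - p) := by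
  rw [M.drift_eq]
  have := M.lam_pos
  have : 0 ≤ p * (1 - p) * (M.lam * x) * y := by
    have := sub_nonneg.2 hp.2
    have := hp.1
    positivity
  linarith

/-! ### Myopic optima -/

lemma Model.IsMyopicOptimum.eq_zero {p y : ℝ} (h : M.IsMyopicOptimum x p y)
    (hlt : M.lam * x * p < M.c) : y = 0 := by
  have h1 := h.2 0 ⟨le_rfl, zero_le_one⟩
  simp only [Model.flowLoss] at h1
  have := h.1.1
  nlinarith

lemma Model.IsMyopicOptimum.eq_one {p y : ℝ} (h : M.IsMyopicOptimum x p y)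
    (hlt : M.c < M.lam * x * p) : y = 1 := by
  have h1 := h.2 1 ⟨zero_le_one, le_rfl⟩
  simp only [Model.flowLoss] at h1
  have := h.1.2
  nlinarith

lemma Model.IsMyopicOptimum.flowLoss_eq {p y : ℝ} (h : M.IsMyopicOptimum x p y) :
    M.flowLoss x p y = min (M.lam * x * p) M.c := by
  rcases lt_trichotomy (M.lam * x * p) M.c with hlt | heq | hlt
  · rw [h.eq_zero hlt, min_eq_left hlt.le]
    simp only [Model.flowLoss]
    ring
  · rw [heq, min_self]
    simp only [Model.flowLoss]
    linear_combination (1 - y) * heq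
  · rw [h.eq_one hlt, min_eq_right hlt.le]
    simp only [Model.flowLoss]
    ring

lemma Model.isMyopicOptimum_of_eq {p y : ℝ} (hy : y ∈ Icc (0 : ℝ) 1)
    (h0 : M.lam * x * p < M.c → y = 0) (h1 : M.c < M.lam * x * p → y = 1) :
    M.IsMyopicOptimum x p y := by
  refine ⟨hy, fun y' hy' => ?_⟩
  simp only [Model.flowLoss]
  rcases lt_trichotomy (M.lam * x * p) M.c with hlt | heq | hlt
  · rw [h0 hlt]
    nlinarith [hy'.1]
  · have : p * M.lam * x = M.c := by linarith
    rw [this]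
    linarith
  · rw [h1 hlt]
    nlinarith [hy'.2]

/-! ### Barriers for trajectories of the belief -/

/-- Barrier arguments start from the last time at or below the level: from then on the function
stays strictly above, so a sign condition on the drift there can be integrated. -/
lemma exists_last_le {f : ℝ → ℝ} {a b l : ℝ} (hab : a ≤ b) (hf : ContinuousOn f (Icc a b))
    (ha : f a ≤ l) (hb : l < f b) : ∃ s ∈ Ico a b, f s ≤ l ∧ ∀ u ∈ Ioc s b, l < f u := by
  have hcl : IsCompact (Icc a b ∩ f ⁻¹' Iic l) :=
    isCompact_Icc.of_isClosed_subset (hf.preimage_isClosed_of_isClosed isClosed_Icc isClosed_Iic)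
      inter_subset_left
  obtain ⟨s, ⟨hs, hsl⟩, hmax⟩ := hcl.exists_isGreatest ⟨a, ⟨le_rfl, hab⟩, ha⟩
  refine ⟨s, ⟨hs.1, lt_of_le_of_ne hs.2 ?_⟩, hsl, fun u hu => ?_⟩
  · rintro rfl
    exact absurd hsl (not_le.2 hb)
  · by_contra hcon
    exact absurd (hmax ⟨⟨hs.1.trans hu.1.le, hu.2⟩, not_lt.1 hcon⟩) (not_le.2 hu.1)

namespace Model.IsBeliefPath

variable {p : ℝ} {φ ψ : ℝ → ℝ}

lemma apply_zero (h : M.IsBeliefPath x y p φ) : φ 0 = p := by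
  simpa using (h.2 0 le_rfl).2.2

lemma mem (h : M.IsBeliefPath x y p φ) {t : ℝ} (ht : 0 ≤ t) : φ t ∈ Icc (0 : ℝ) 1 := (h.2 t ht).1

lemma continuousOn_Icc (h : M.IsBeliefPath x y p φ) {s t : ℝ} (hs : 0 ≤ s) :
    ContinuousOn φ (Icc s t) := h.1.mono fun _ hu => hs.trans hu.1

lemma intervalIntegrable (h : M.IsBeliefPath x y p φ) {s t : ℝ} (hs : 0 ≤ s) (ht : 0 ≤ t) :
    IntervalIntegrable (fun s => M.drift x (φ s) (y (φ s))) volume s t :=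
  (h.2 s hs).2.1.symm.trans (h.2 t ht).2.1

lemma sub_eq (h : M.IsBeliefPath x y p φ) {s t : ℝ} (hs : 0 ≤ s) (ht : 0 ≤ t) :
    φ t - φ s = ∫ u in s..t, M.drift x (φ u) (y (φ u)) := by
  rw [(h.2 s hs).2.2, (h.2 t ht).2.2, add_sub_add_left_eq_sub,
    intervalIntegral.integral_interval_sub_left (h.2 t ht).2.1 (h.2 s hs).2.1]

lemma le_of_le (h : M.IsBeliefPath x y p φ) {l s t : ℝ} (hs : 0 ≤ s) (hst : s ≤ t) (hl : φ s ≤ l)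
    (hd : ∀ u ∈ Icc (0 : ℝ) 1, l < u → M.drift x u (y u) ≤ 0) : φ t ≤ l := by
  by_contra! hcon
  obtain ⟨a, ha, hal, hgt⟩ := exists_last_le hst (h.continuousOn_Icc hs) hl hcon
  have ha0 : 0 ≤ a := hs.trans ha.1
  have h1 := h.sub_eq ha0 (ha0.trans ha.2.le)
  have h2 : ∫ u in a..t, M.drift x (φ u) (y (φ u)) ≤ 0 := by
    rw [intervalIntegral.integral_of_le ha.2.le]
    exact setIntegral_nonpos measurableSet_Ioc fun u hu =>
      hd _ (h.mem (ha0.trans hu.1.le)) (hgt u hu)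
  linarith

lemma ge_of_ge (h : M.IsBeliefPath x y p φ) {l s t : ℝ} (hs : 0 ≤ s) (hst : s ≤ t) (hl : l ≤ φ s)
    (hd : ∀ u ∈ Icc (0 : ℝ) 1, u < l → 0 ≤ M.drift x u (y u)) : l ≤ φ t := by
  by_contra! hcon
  obtain ⟨a, ha, hal, hgt⟩ := exists_last_le (f := fun u => -φ u) (l := -l) hst
    (h.continuousOn_Icc hs).neg (by linarith) (by linarith)
  have ha0 : 0 ≤ a := hs.trans ha.1
  have h1 := h.sub_eq ha0 (ha0.trans ha.2.le)
  have h2 : 0 ≤ ∫ u in a..t, M.drift x (φ u) (y (φ u)) := by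
    rw [intervalIntegral.integral_of_le ha.2.le]
    exact setIntegral_nonneg measurableSet_Ioc fun u hu =>
      hd _ (h.mem (ha0.trans hu.1.le)) (by linarith [hgt u hu])
  linarith

/-- The drift under a monotone policy is one-sided Lipschitz, whence trajectories compare. -/
lemma le_of_monotoneOn (hx : x ∈ Icc (0 : ℝ) 1) (hy : MonotoneOn y (Icc 0 1))
    (hy01 : ∀ u ∈ Icc (0 : ℝ) 1, y u ∈ Icc (0 : ℝ) 1) (h : M.IsBeliefPath x y p φ)
    (h' : M.IsBeliefPath x y p ψ) {t : ℝ} (ht : 0 ≤ t) : φ t ≤ ψ t := by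
  have hk : 0 ≤ M.lam * x := mul_nonneg M.lam_pos.le hx.1
  set k := M.lam * x with hkdef
  have lip : ∀ u ∈ Icc (0 : ℝ) 1, ∀ v ∈ Icc (0 : ℝ) 1, v < u →
      M.drift x u (y u) - M.drift x v (y v) ≤ k * (u - v) := by
    intro u hu v hv huv
    rw [M.drift_eq, M.drift_eq, ← hkdef]
    have h1 := M.switch_pos
    have h2 := hy hv hu huv.le
    have h3 := hy01 u hu
    -- Monotonicity enters here: an upward jump of the policy only lowers the drift, so
    -- discontinuities do no harm.
    have h4 : 0 ≤ v * (1 - v) * (y u - y v) :=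
      mul_nonneg (mul_nonneg hv.1 (by linarith [hv.2])) (by linarith)
    have h5 : -(u - v) ≤ (u * (1 - u) - v * (1 - v)) * y u := by
      have : u * (1 - u) - v * (1 - v) = (u - v) * (1 - u - v) := by ring
      rw [this, mul_assoc]
      have h6 : -1 ≤ (1 - u - v) * y u := by nlinarith [hu.2, hv.2, hu.1, hv.1, h3.1, h3.2]
      nlinarith
    nlinarith [mul_le_mul_of_nonneg_left h5 hk, mul_nonneg hk h4, mul_pos h1 (sub_pos.2 huv)]
  by_contra! hcon
  have hcont : ContinuousOn (fun s => φ s - ψ s) (Ici 0) := h.1.sub h'.1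
  obtain ⟨a, ha, hal, hgt⟩ := exists_last_le (f := fun s => φ s - ψ s) (l := 0) ht
    (hcont.mono Icc_subset_Ici_self) (by simp [h.apply_zero, h'.apply_zero]) (by linarith)
  -- Gronwall in one step: on a window this short, `k` times the length is at most `1/2`, so the
  -- maximum of `φ - ψ` on it would be at most half of itself, although it is positive.
  set b := min t (a + 1 / (2 * (k + 1))) with hb
  have hk1 : 0 < 1 / (2 * (k + 1)) := by positivity
  have hab : a < b := lt_min ha.2 (by linarith)
  obtain ⟨m, hm, hmax⟩ := isCompact_Icc.exists_isMaxOn (nonempty_Icc.2 hab.le)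
    (hcont.mono (Icc_subset_Ici_self.trans (Ici_subset_Ici.2 ha.1)))
  have hbpos : 0 < φ b - ψ b := hgt b ⟨hab, min_le_left _ _⟩
  have hmb : φ b - ψ b ≤ φ m - ψ m := hmax ⟨hab.le, le_rfl⟩
  have hm0 : 0 ≤ m := ha.1.trans hm.1
  have key : (φ m - ψ m) - (φ a - ψ a) ≤ k * (φ m - ψ m) * (m - a) := by
    have e1 := h.sub_eq ha.1 hm0
    have e2 := h'.sub_eq ha.1 hm0
    have e3 : (φ m - ψ m) - (φ a - ψ a) = (φ m - φ a) - (ψ m - ψ a) := by ring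
    rw [e3, e1, e2, ← intervalIntegral.integral_sub (h.intervalIntegrable ha.1 hm0)
      (h'.intervalIntegrable ha.1 hm0)]
    have e4 : k * (φ m - ψ m) * (m - a) = ∫ _ in a..m, k * (φ m - ψ m) := by
      rw [intervalIntegral.integral_const, smul_eq_mul, mul_comm]
    rw [e4, intervalIntegral.integral_of_le hm.1, intervalIntegral.integral_of_le hm.1]
    refine setIntegral_mono_on ?_ intervalIntegrable_const.1 measurableSet_Ioc fun u hu => ?_
    · exact (((h.intervalIntegrable ha.1 hm0).sub (h'.intervalIntegrable ha.1 hm0)).1)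
    · have hu0 : 0 ≤ u := ha.1.trans hu.1.le
      have hub : u ≤ b := hu.2.trans hm.2
      have := hgt u ⟨hu.1, hub.trans (min_le_left _ _)⟩
      refine (lip _ (h.mem hu0) _ (h'.mem hu0) (by linarith)).trans ?_
      exact mul_le_mul_of_nonneg_left (hmax ⟨hu.1.le, hub⟩) hk
  have hma : m - a ≤ 1 / (2 * (k + 1)) := by
    have := hm.2.trans (min_le_right t _)
    linarith
  have hfin : k * (m - a) ≤ 1 / 2 := by
    calc k * (m - a) ≤ k * (1 / (2 * (k + 1))) := mul_le_mul_of_nonneg_left hma hk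
      _ = (k / (k + 1)) / 2 := by field_simp
      _ ≤ 1 / 2 := by
        have : k / (k + 1) ≤ 1 := (div_le_one (by linarith)).2 (by linarith)
        linarith
  nlinarith

end Model.IsBeliefPath

/-- Comparison in both directions yields uniqueness; existence has to be supplied by an explicit
trajectory, as the policy may be discontinuous. -/
lemma Model.admissible_of_monotoneOn (hx : x ∈ Icc (0 : ℝ) 1) (hy : MonotoneOn y (Icc 0 1))
    (hy01 : ∀ u ∈ Icc (0 : ℝ) 1, y u ∈ Icc (0 : ℝ) 1)
    (hex : ∀ p ∈ Icc (0 : ℝ) 1, ∃ φ, M.IsBeliefPath x y p φ) : M.Admissible x y := fun p hp => by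
  obtain ⟨φ, hφ⟩ := hex p hp
  exact ⟨φ, hφ, fun ψ hψ t ht => le_antisymm (hψ.le_of_monotoneOn hx hy hy01 hφ ht)
    (hφ.le_of_monotoneOn hx hy hy01 hψ ht)⟩

lemma Model.Admissible.isBeliefPath (h : M.Admissible x y) {p : ℝ} (hp : p ∈ Icc (0 : ℝ) 1) :
    M.IsBeliefPath x y p (M.beliefPath x y p) := by
  obtain ⟨φ, hφ, -⟩ := h p hp
  have hex : ∃ φ : ℝ → ℝ, M.IsBeliefPath x y p φ := ⟨φ, hφ⟩
  rw [Model.beliefPath, dif_pos hex]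
  exact hex.choose_spec

lemma Model.Admissible.beliefPath_eq (h : M.Admissible x y) {p : ℝ} (hp : p ∈ Icc (0 : ℝ) 1)
    {φ : ℝ → ℝ} (hφ : M.IsBeliefPath x y p φ) {t : ℝ} (ht : 0 ≤ t) :
    M.beliefPath x y p t = φ t := by
  obtain ⟨ψ, -, hu⟩ := h p hp
  exact (hu _ (h.isBeliefPath hp) ht).trans (hu _ hφ ht).symm

/-! ### Waiting times -/

lemma sampleMeasure_le (n : ℕ) (u : ℝ) :
    sampleMeasure {ω | ω n ≤ u} = expMeasure 1 (Iic u) :=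
  (measurePreserving_eval_infinitePi (fun _ : ℕ => expMeasure 1) n).measure_preimage
    measurableSet_Iic.nullMeasurableSet

instance : IsProbabilityMeasure sampleMeasure := by
  unfold sampleMeasure
  infer_instance

lemma expMeasure_one_Iic (u : ℝ) :
    expMeasure 1 (Iic u) = ENNReal.ofReal (if 0 ≤ u then 1 - Real.exp (-u) else 0) := by
  rw [← ofReal_cdf, cdf_expMeasure_eq one_pos, one_mul]

lemma expMeasure_one_Ioi {u : ℝ} (hu : 0 ≤ u) :
    expMeasure 1 (Ioi u) = ENNReal.ofReal (Real.exp (-u)) := by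
  rw [← compl_Iic, prob_compl_eq_one_sub measurableSet_Iic, expMeasure_one_Iic, if_pos hu,
    ← ENNReal.ofReal_one, ← ENNReal.ofReal_sub _ (by simpa using hu)]
  simp

lemma ae_sample_pos : ∀ᵐ ω ∂sampleMeasure, ∀ n : ℕ, 0 < ω n := by
  rw [ae_all_iff]
  intro n
  have h := sampleMeasure_le n 0
  rw [expMeasure_one_Iic] at h
  rw [ae_iff]
  simpa using h

lemma Model.abs_detectionRate_le {p u : ℝ} (hx : x ∈ Icc (0 : ℝ) 1) (hp : p ∈ Icc (0 : ℝ) 1)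
    (hu : u ∈ Icc (0 : ℝ) 1) : |M.detectionRate x p u| ≤ M.lam := by
  have hl := M.lam_pos
  have := hp.1; have := hx.1; have := hu.1
  rw [Model.detectionRate, abs_of_nonneg (by positivity)]
  calc p * M.lam * x * u ≤ 1 * M.lam * 1 * 1 := by
        gcongr
        exacts [hp.2, hx.2, hu.2]
    _ = M.lam := by ring

lemma Model.cumulativeRate_le (hx : x ∈ Icc (0 : ℝ) 1)
    (hy01 : ∀ u ∈ Icc (0 : ℝ) 1, y u ∈ Icc (0 : ℝ) 1) (h : M.Admissible x y) {p : ℝ}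
    (hp : p ∈ Icc (0 : ℝ) 1) {t : ℝ} (ht : 0 ≤ t) : M.cumulativeRate x y p t ≤ M.lam * t := by
  have := intervalIntegral.norm_integral_le_of_norm_le_const (a := 0) (b := t) (C := M.lam)
    (f := fun s => M.detectionRate x (M.beliefPath x y p s) (y (M.beliefPath x y p s)))
    fun s hs => by
      rw [uIoc_of_le ht] at hs
      have hm := (h.isBeliefPath hp).mem hs.1.le
      exact M.abs_detectionRate_le hx hm (hy01 _ hm)
  rw [sub_zero, abs_of_nonneg ht] at this
  exact (Real.le_norm_self _).trans this

/-- Detections accumulate at rate at most `λ`, so a threshold `e` takes at least time `e / λ`. This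
bounds the probability of no detection from below, uniformly in the initial belief. -/
lemma Model.lt_waitingTime (hx : x ∈ Icc (0 : ℝ) 1)
    (hy01 : ∀ u ∈ Icc (0 : ℝ) 1, y u ∈ Icc (0 : ℝ) 1) (h : M.Admissible x y) {p : ℝ}
    (hp : p ∈ Icc (0 : ℝ) 1) {T e : ℝ} (hT : 0 ≤ T) (he : M.lam * T < e) :
    ENNReal.ofReal T < M.waitingTime x y p e := by
  have hl := M.lam_pos
  have h1 : T < e / M.lam := by rwa [lt_div_iff₀ hl, mul_comm]
  refine ((ENNReal.ofReal_lt_ofReal_iff (hT.trans_lt h1)).2 h1).trans_le ?_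
  refine le_iInf₂ fun t ht => ENNReal.ofReal_le_ofReal ?_
  rw [div_le_iff₀ hl, mul_comm]
  exact ht.2.trans (M.cumulativeRate_le hx hy01 h hp ht.1)

lemma Model.waitingTime_eq_top {p e : ℝ} (he : 0 < e)
    (h0 : ∀ s, 0 ≤ s → M.detectionRate x (M.beliefPath x y p s) (y (M.beliefPath x y p s)) = 0) :
    M.waitingTime x y p e = ⊤ := by
  simp only [Model.waitingTime, iInf_eq_top]
  rintro t ⟨ht, het⟩
  have : M.cumulativeRate x y p t = 0 := by
    rw [Model.cumulativeRate, intervalIntegral.integral_of_le ht]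
    exact setIntegral_eq_zero_of_forall_eq_zero fun s hs => h0 s hs.1.le
  linarith

lemma Model.lastDetection_le (p : ℝ) (ω : Sample) {t : ℝ} (ht : 0 ≤ t) :
    M.lastDetection x y p ω t ≤ t := by
  rw [Model.lastDetection]
  refine ENNReal.toReal_le_of_le_ofReal ht (iSup_le fun n => ?_)
  split_ifs with h
  · exact h
  · exact zero_le

/-! ### Losses in equilibrium -/

lemma Model.integral_discount (M : Model) (C : ℝ) :
    ∫ t in Ioi (0 : ℝ), C * Real.exp (-M.r * t) = C / M.r := by
  rw [integral_const_mul, integral_exp_mul_Ioi (neg_lt_zero.2 M.r_pos)]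
  simp [div_eq_mul_inv]

lemma Model.IsNPEquilibrium.lossNP_eq {y : ℝ} (h : M.IsNPEquilibrium x y) :
    M.lossNP x y = min (M.lam * M.pi0) M.c / M.r := by
  have hl := M.lam_pos
  have hp := M.pi0_pos
  obtain ⟨hopt, hx, h0, h1⟩ := h
  rw [Model.lossNP, M.integral_discount, hopt.flowLoss_eq]
  congr 1
  rcases lt_trichotomy (M.lam * x * M.pi0) M.c with hlt | heq | hlt
  · have hx1 : x = 1 := h1 (by rw [hopt.eq_zero hlt]; exact M.ybar_pos)
    rw [hx1, mul_one]
  · have : M.c ≤ M.lam * M.pi0 := by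
      rw [← heq]
      nlinarith [hx.2, mul_pos hl hp]
    rw [heq, min_self, min_eq_right this]
  · have hx0 : x = 0 := h0 (by rw [hopt.eq_one hlt]; exact M.ybar_lt_one)
    rw [hx0] at hlt
    linarith [M.c_pos]

lemma Model.exists_isNPEquilibrium (M : Model) : ∃ x y, M.IsNPEquilibrium x y := by
  have hl := M.lam_pos
  have hp := M.pi0_pos
  have hc := M.c_pos
  have hb := M.ybar_pos
  rcases le_or_gt (M.lam * M.pi0) M.c with h | h
  · exact ⟨1, 0, isMyopicOptimum_of_eq ⟨le_rfl, zero_le_one⟩ (fun _ => rfl)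
      (fun h' => by linarith), ⟨zero_le_one, le_rfl⟩, fun h' => absurd h' (not_lt.2 hb.le),
      fun _ => rfl⟩
  -- This crime level makes the policymaker indifferent at `π₀`; she may then enforce at `ybar`,
  -- which makes the criminals indifferent.
  · have heq : M.lam * (M.c / (M.lam * M.pi0)) * M.pi0 = M.c := by field_simp
    refine ⟨M.c / (M.lam * M.pi0), M.ybar, isMyopicOptimum_of_eq ⟨hb.le, M.ybar_lt_one.le⟩
      (fun h' => absurd heq h'.ne) (fun h' => absurd heq h'.ne'), ⟨by positivity, ?_⟩,
      fun h' => absurd h' (lt_irrefl _), fun h' => absurd h' (lt_irrefl _)⟩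
    exact (div_le_one (by positivity)).2 h.le

/-! ### The belief process under a greedy policy -/

section Greedy

variable (hx : x ∈ Icc (0 : ℝ) 1) (hadm : M.Admissible x y)
  (hopt : ∀ p ∈ Icc (0 : ℝ) 1, M.IsMyopicOptimum x p (y p))

include hopt

lemma drift_nonneg_of_lt (p : ℝ) (hp : p ∈ Icc (0 : ℝ) 1) (hc : M.lam * x * p < M.c)
    (hpi : p ≤ M.pi0) : 0 ≤ M.drift x p (y p) := by
  rw [(hopt p hp).eq_zero hc, M.drift_eq, mul_zero, sub_zero]
  exact mul_nonneg M.switch_pos.le (by linarith)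

include hx

lemma drift_nonpos_of_pi0_le (p : ℝ) (hp : p ∈ Icc (0 : ℝ) 1) (hpi : M.pi0 ≤ p) :
    M.drift x p (y p) ≤ 0 :=
  (M.drift_le hx.1 hp (hopt p hp).1.1).trans
    (mul_nonpos_of_nonneg_of_nonpos M.switch_pos.le (by linarith))

include hadm

/-- `π₀` is a barrier from both sides: above it the drift is nonpositive whatever the enforcement,
and strictly below it the belief is strictly below the cutoff, hence unenforced and drifting up. -/
lemma beliefPath_pi0 (hc : M.lam * x * M.pi0 ≤ M.c) {t : ℝ} (ht : 0 ≤ t) :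
    M.beliefPath x y M.pi0 t = M.pi0 := by
  have h := hadm.isBeliefPath M.pi0_mem
  have hk : 0 ≤ M.lam * x := mul_nonneg M.lam_pos.le hx.1
  refine le_antisymm (h.le_of_le le_rfl ht h.apply_zero.le fun u hu hlt =>
    drift_nonpos_of_pi0_le hx hopt u hu hlt.le) (h.ge_of_ge le_rfl ht h.apply_zero.ge
    fun u hu hlt => drift_nonneg_of_lt hopt u hu ?_ hlt.le)
  rcases hk.eq_or_lt with h0 | h0
  · rw [← h0, zero_mul]
    exact M.c_pos
  · exact (mul_lt_mul_of_pos_left hlt h0).trans_le hc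

/-- At the tie `λ x π₀ = c`, optimality leaves the enforcement free. Admissibility decides: the
trajectory is constant, so the drift at `π₀` vanishes, and this drift is `-(1 - π₀)` times the
detection rate. -/
lemma detectionRate_pi0 (hc : M.lam * x * M.pi0 ≤ M.c) :
    M.detectionRate x M.pi0 (y M.pi0) = 0 := by
  have h := (hadm.isBeliefPath M.pi0_mem).sub_eq (s := 0) (t := 1) le_rfl zero_le_one
  have hcongr : ∫ u in (0 : ℝ)..1, M.drift x (M.beliefPath x y M.pi0 u)
      (y (M.beliefPath x y M.pi0 u)) = ∫ _ in (0 : ℝ)..1, M.drift x M.pi0 (y M.pi0) := by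
    refine intervalIntegral.integral_congr fun u hu => ?_
    rw [uIcc_of_le zero_le_one] at hu
    simp only [beliefPath_pi0 hx hadm hopt hc hu.1]
  rw [hcongr, beliefPath_pi0 hx hadm hopt hc le_rfl, beliefPath_pi0 hx hadm hopt hc zero_le_one,
    M.drift_eq] at h
  simp only [sub_self, mul_zero, zero_sub, intervalIntegral.integral_const, sub_zero,
    smul_eq_mul, one_mul] at h
  have h1 : (1 - M.pi0) * M.detectionRate x M.pi0 (y M.pi0) = 0 := by
    rw [Model.detectionRate]
    linear_combination h
  exact (mul_eq_zero.1 h1).resolve_left (by linarith [M.pi0_lt_one])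

lemma belief_pi0 (hc : M.lam * x * M.pi0 ≤ M.c) {t : ℝ} (ht : 0 ≤ t) {ω : Sample}
    (hω : 0 < ω 0) : M.belief x y M.pi0 t ω = M.pi0 := by
  have h : M.detectionTime x y M.pi0 ω 0 = ⊤ := Model.waitingTime_eq_top hω fun s hs => by
    rw [beliefPath_pi0 hx hadm hopt hc hs, detectionRate_pi0 hx hadm hopt hc]
  rw [Model.belief, h, if_neg (by simp), beliefPath_pi0 hx hadm hopt hc ht]

lemma expectedLoss_pi0 (hc : M.lam * x * M.pi0 ≤ M.c) :
    M.expectedLoss x y M.pi0 = M.lam * x * M.pi0 / M.r := by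
  rw [Model.expectedLoss]
  have : ∀ᵐ ω ∂sampleMeasure, (∫ t in Ioi (0 : ℝ), M.flowLoss x (M.belief x y M.pi0 t ω)
      (y (M.belief x y M.pi0 t ω)) * Real.exp (-M.r * t)) = M.lam * x * M.pi0 / M.r := by
    filter_upwards [ae_sample_pos] with ω hω
    rw [← M.integral_discount]
    refine setIntegral_congr_fun measurableSet_Ioi fun t ht => ?_
    simp only [belief_pi0 hx hadm hopt hc (mem_Ioi.1 ht).le (hω 0),
      (hopt _ M.pi0_mem).flowLoss_eq, min_eq_left hc]
  rw [integral_congr_ae this]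
  simp

lemma beliefPath_ge_cutoff (hc : M.c < M.lam * x * M.pi0) {p t : ℝ} (hp : p ∈ Icc (0 : ℝ) 1)
    (hpc : M.c ≤ M.lam * x * p) (ht : 0 ≤ t) : M.c ≤ M.lam * x * M.beliefPath x y p t := by
  have hk : 0 < M.lam * x := lt_of_le_of_ne (mul_nonneg M.lam_pos.le hx.1) fun h0 => by
    rw [← h0, zero_mul] at hc
    linarith [M.c_pos]
  have h := hadm.isBeliefPath hp
  rw [← div_le_iff₀' hk] at hpc ⊢
  refine h.ge_of_ge le_rfl ht (by rwa [h.apply_zero]) fun u hu hlt => ?_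
  rw [lt_div_iff₀' hk] at hlt
  exact drift_nonneg_of_lt hopt u hu hlt (le_of_mul_le_mul_left (hlt.trans hc).le hk)

/-- The restart point one also lies above the cutoff, so detections never lead below it; the loss is
the same for every sample, without any probabilistic estimate. -/
lemma expectedLoss_of_cutoff_lt (hc : M.c < M.lam * x * M.pi0) {p : ℝ} (hp : p ∈ Icc (0 : ℝ) 1)
    (hpc : M.c ≤ M.lam * x * p) : M.expectedLoss x y p = M.c / M.r := by
  have hone : M.c ≤ M.lam * x * 1 := hc.le.trans (mul_le_mul_of_nonneg_left M.pi0_lt_one.le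
    (mul_nonneg M.lam_pos.le hx.1))
  have h1 : (1 : ℝ) ∈ Icc (0 : ℝ) 1 := ⟨zero_le_one, le_rfl⟩
  have key : ∀ ω, ∀ t, 0 ≤ t → M.belief x y p t ω ∈ Icc (0 : ℝ) 1 ∧
      M.c ≤ M.lam * x * M.belief x y p t ω := by
    intro ω t ht
    rw [Model.belief]
    split_ifs with hd
    · have h0 := sub_nonneg.2 (M.lastDetection_le (x := x) (y := y) p ω ht)
      exact ⟨(hadm.isBeliefPath h1).mem h0, beliefPath_ge_cutoff hx hadm hopt hc h1 hone h0⟩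
    · exact ⟨(hadm.isBeliefPath hp).mem ht, beliefPath_ge_cutoff hx hadm hopt hc hp hpc ht⟩
  rw [Model.expectedLoss]
  have : ∀ ω : Sample, (∫ t in Ioi (0 : ℝ), M.flowLoss x (M.belief x y p t ω)
      (y (M.belief x y p t ω)) * Real.exp (-M.r * t)) = M.c / M.r := by
    intro ω
    rw [← M.integral_discount]
    refine setIntegral_congr_fun measurableSet_Ioi fun t ht => ?_
    obtain ⟨hm, hge⟩ := key ω t (mem_Ioi.1 ht).le
    simp only [(hopt _ hm).flowLoss_eq, min_eq_right hge]
  rw [integral_congr_ae (Filter.Eventually.of_forall this)]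
  simp

/-- When the cutoff exceeds `pi0`, no enforcement takes place in the long run. -/
lemma stationary_enforced_eq_zero (hc : M.lam * x * M.pi0 < M.c) {Φ : Measure ℝ}
    (hΦ : M.IsStationary x y Φ) :
    Φ {p | p ∈ Icc (0 : ℝ) 1 ∧ M.c ≤ M.lam * x * p} = 0 := by
  obtain ⟨hprob, hsupp, hstat⟩ := hΦ
  have hy01 : ∀ u ∈ Icc (0 : ℝ) 1, y u ∈ Icc (0 : ℝ) 1 := fun u hu => (hopt u hu).1
  have hk : 0 ≤ M.lam * x := mul_nonneg M.lam_pos.le hx.1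
  rcases hk.eq_or_lt with h0 | hk
  · have : {p | p ∈ Icc (0 : ℝ) 1 ∧ M.c ≤ M.lam * x * p} = ∅ := by
      ext p
      simp [← h0, M.c_pos]
    rw [this, measure_empty]
  set q := M.c / (M.lam * x) with hq
  have hqle : ∀ p, M.c ≤ M.lam * x * p ↔ q ≤ p := fun p => by rw [hq, div_le_iff₀' hk]
  have hpq : M.pi0 < q := by rwa [hq, lt_div_iff₀' hk]
  simp only [hqle]
  set A := {p : ℝ | p ∈ Icc (0 : ℝ) 1 ∧ q ≤ p} with hA
  have hAm : MeasurableSet A := measurableSet_Icc.inter measurableSet_Ici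
  -- a trajectory that has left `A` stays outside
  have stay : ∀ p ∈ Icc (0 : ℝ) 1, ∀ s t, 0 ≤ s → s ≤ t → M.beliefPath x y p s < q →
      M.beliefPath x y p t < q := by
    intro p hp s t hs hst hlt
    have h := hadm.isBeliefPath hp
    exact (h.le_of_le hs hst (le_max_left _ M.pi0) fun u hu hlt =>
      drift_nonpos_of_pi0_le hx hopt u hu ((le_max_right _ _).trans hlt.le)).trans_lt
      (max_lt hlt hpq)
  -- On `A` the drift is at most `-ε`, so a stay of length `2 / ε` would lower the belief by two,
  -- more than the width of `[0, 1]`.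
  set ε := (M.rhoH + M.rhoL) * (q - M.pi0) with hε
  have hεpos : 0 < ε := mul_pos M.switch_pos (sub_pos.2 hpq)
  set T := 2 / ε with hT
  have hTpos : 0 < T := by positivity
  -- without detections, every trajectory is outside `A` at time `T`
  have leave : ∀ p ∈ Icc (0 : ℝ) 1, M.beliefPath x y p T < q := by
    intro p hp
    have h := hadm.isBeliefPath hp
    by_contra! hcon
    have hin : ∀ s ∈ Icc 0 T, q ≤ M.beliefPath x y p s := fun s hs => by
      by_contra! hlt
      exact absurd (stay p hp s T hs.1 hs.2 hlt) (not_lt.2 hcon)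
    have h1 := h.sub_eq le_rfl hTpos.le
    have h2 : ∫ u in (0 : ℝ)..T, M.drift x (M.beliefPath x y p u) (y (M.beliefPath x y p u)) ≤
        ∫ _ in (0 : ℝ)..T, -ε := by
      refine intervalIntegral.integral_mono_on hTpos.le (h.intervalIntegrable le_rfl hTpos.le)
        intervalIntegrable_const fun u hu => ?_
      have hm := h.mem hu.1
      refine (M.drift_le hx.1 hm (hy01 _ hm).1).trans ?_
      have := mul_le_mul_of_nonneg_left (hin u hu) M.switch_pos.le
      rw [hε]
      linarith
    rw [intervalIntegral.integral_const, sub_zero, smul_eq_mul, mul_neg, hT,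
      div_mul_cancel₀ _ hεpos.ne'] at h2
    have h3 := (h.mem le_rfl).2
    have h4 := (h.mem hTpos.le).1
    linarith
  -- To be in `A` at time `T` requires a detection before, hence a first threshold of at most `λ T`.
  have bound_in : ∀ p ∈ Icc (0 : ℝ) 1, sampleMeasure {ω | M.belief x y p T ω ∈ A} ≤
      ENNReal.ofReal (1 - Real.exp (-(M.lam * T))) := by
    intro p hp
    have h := sampleMeasure_le 0 (M.lam * T)
    rw [expMeasure_one_Iic, if_pos (mul_nonneg M.lam_pos.le hTpos.le)] at h
    rw [← h]
    refine measure_mono fun ω hω => ?_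
    by_contra hcon
    have hgt := M.lt_waitingTime hx hy01 hadm hp hTpos.le (not_le.1 hcon)
    have hω' : M.belief x y p T ω ∈ A := hω
    rw [Model.belief, if_neg (not_le.2 (by exact hgt))] at hω'
    exact absurd (leave p hp) (not_lt.2 hω'.2)
  -- Below the cutoff nothing is enforced and nothing detected, so the complement of `A` is almost
  -- surely never left.
  have bound_out : ∀ p ∈ Icc (0 : ℝ) 1, p < q →
      sampleMeasure {ω | M.belief x y p T ω ∈ A} = 0 := by
    intro p hp hlt
    have hpath : ∀ s, 0 ≤ s → M.beliefPath x y p s < q := fun s hs =>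
      stay p hp 0 s le_rfl hs (by rwa [(hadm.isBeliefPath hp).apply_zero])
    rw [← nonpos_iff_eq_zero, ← ae_iff.1 ae_sample_pos]
    refine measure_mono fun ω hω hpos => ?_
    have htop : M.detectionTime x y p ω 0 = ⊤ := Model.waitingTime_eq_top (hpos 0) fun s hs => by
      have hm := (hadm.isBeliefPath hp).mem hs
      have hc' : M.lam * x * M.beliefPath x y p s < M.c := by
        rw [← not_le, hqle, not_le]
        exact hpath s hs
      rw [Model.detectionRate, (hopt _ hm).eq_zero hc', mul_zero]
    have hω' : M.belief x y p T ω ∈ A := hω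
    rw [Model.belief, htop, if_neg (by simp)] at hω'
    exact absurd (hpath T hTpos.le) (not_lt.2 hω'.2)
  set κ := ENNReal.ofReal (1 - Real.exp (-(M.lam * T))) with hκ
  have hκ1 : κ < 1 := by
    rw [hκ, ENNReal.ofReal_lt_one]
    linarith [Real.exp_pos (-(M.lam * T))]
  -- Stationarity at time `T`: mass in `A` comes only from `A`, with probability at most `κ < 1`, so
  -- there is none.
  have hle : Φ A ≤ κ * Φ A := by
    conv_lhs => rw [← hstat T hTpos.le A hAm]
    rw [← lintegral_indicator_const hAm κ]
    refine lintegral_mono_ae ?_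
    have hae : ∀ᵐ p ∂Φ, p ∈ Icc (0 : ℝ) 1 := hsupp
    filter_upwards [hae] with p hp
    by_cases hpA : p ∈ A
    · rw [indicator_of_mem hpA]
      exact bound_in p hp
    · rw [bound_out p hp (by by_contra! hcon; exact hpA ⟨hp, hcon⟩)]
      exact zero_le
  by_contra hne
  have hlt : κ * Φ A < 1 * Φ A :=
    (ENNReal.mul_lt_mul_iff_left hne (measure_ne_top _ _)).2 hκ1
  rw [one_mul] at hlt
  exact absurd hle (not_le.2 hlt)

end Greedy

lemma Model.IsGPEquilibrium.eq_one_of_lt (h : M.IsGPEquilibrium x y)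
    (hc : M.lam * x * M.pi0 < M.c) : x = 1 := by
  obtain ⟨hadm, hopt, Φ, hΦ, hx, -, h1⟩ := h
  refine h1 ?_
  have hz := stationary_enforced_eq_zero hx hadm hopt hc hΦ
  have hae : ∀ᵐ p ∂Φ, y p = 0 := by
    have h1 : ∀ᵐ p ∂Φ, p ∈ Icc (0 : ℝ) 1 := hΦ.2.1
    have h2 : ∀ᵐ p ∂Φ, ¬ (p ∈ Icc (0 : ℝ) 1 ∧ M.c ≤ M.lam * x * p) := by
      rw [ae_iff]
      simpa only [not_not] using hz
    filter_upwards [h1, h2] with p hp hn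
    exact (hopt p hp).eq_zero (by by_contra! hcon; exact hn ⟨hp, hcon⟩)
  have hae' : ∀ᵐ p ∂(M.conditionalOnHigh Φ), y p = 0 :=
    (withDensity_absolutelyContinuous _ _).ae_le hae
  rw [integral_eq_zero_of_ae hae']
  exact M.ybar_pos

lemma Model.IsGPEquilibrium.expectedLoss_eq (h : M.IsGPEquilibrium x y) {p : ℝ}
    (hp : p ∈ M.longRunPriors x) :
    M.expectedLoss x y p = min (M.lam * M.pi0) M.c / M.r := by
  obtain ⟨hadm, hopt, Φ, hΦ, hx, -⟩ := id h
  have hmono : M.lam * x * M.pi0 ≤ M.lam * M.pi0 := by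
    nlinarith [hx.2, mul_pos M.lam_pos M.pi0_pos]
  rw [Model.longRunPriors, mem_ofPred_eq] at hp
  split_ifs at hp with hc
  · rw [hp, expectedLoss_pi0 hx hadm hopt hc]
    rcases hc.lt_or_eq with hlt | heq
    · rw [h.eq_one_of_lt hlt, mul_one] at hc ⊢
      rw [min_eq_left hc]
    · rw [heq, min_eq_right (heq ▸ hmono)]
  · rw [not_le] at hc
    rw [expectedLoss_of_cutoff_lt hx hadm hopt hc hp.1 hp.2.1, min_eq_right (hc.le.trans hmono)]

/-- The point mass at `pi0` is stationary when the cutoff is at least `pi0`. -/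
lemma isStationary_dirac_pi0 (hx : x ∈ Icc (0 : ℝ) 1) (hadm : M.Admissible x y)
    (hopt : ∀ p ∈ Icc (0 : ℝ) 1, M.IsMyopicOptimum x p (y p)) (hc : M.lam * x * M.pi0 ≤ M.c) :
    M.IsStationary x y (Measure.dirac M.pi0) := by
  refine ⟨inferInstance, ?_, fun t ht B hB => ?_⟩
  · rw [Measure.dirac_apply' _ measurableSet_Icc.compl]
    simp [M.pi0_pos.le, M.pi0_lt_one.le]
  · rw [lintegral_dirac, Measure.dirac_apply' _ hB]
    have : {ω | M.belief x y M.pi0 t ω ∈ B} =ᵐ[sampleMeasure] {_ω : Sample | M.pi0 ∈ B} := by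
      rw [Filter.eventuallyEq_set]
      filter_upwards [ae_sample_pos] with ω hω
      simp only [belief_pi0 hx hadm hopt hc ht (hω 0)]
    rw [measure_congr this]
    by_cases hB' : M.pi0 ∈ B <;> simp [hB']

/-! ### Renewal processes in terms of their cumulative hazard -/

/-- `H` is a cumulative hazard whose rate lies between the positive numbers `c₁` and `c₂`. -/
structure IsHazard (H : ℝ → ℝ) (c₁ c₂ : ℝ) : Prop where
  zero : H 0 = 0
  pos : 0 < c₁
  lower : ∀ s t, s ≤ t → c₁ * (t - s) ≤ H t - H s
  upper : ∀ s t, s ≤ t → H t - H s ≤ c₂ * (t - s)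

/-- The waiting time of an item of age `a` whose exponential threshold is `e`. -/
noncomputable def hazardWait (H : ℝ → ℝ) (a e : ℝ) : ℝ :=
  sInf {t | 0 ≤ t ∧ e ≤ H (a + t) - H a}

/-- The age of the item in use before the `n`-th renewal, at the time it is put to use. -/
def startAge (a : ℝ) : ℕ → ℝ
  | 0 => a
  | _ + 1 => 0

/-- The time of the `n`-th renewal when the initial item has age `a`. -/
noncomputable def renewalTime (H : ℝ → ℝ) (n : ℕ) (a : ℝ) (ω : Sample) : ℝ :=
  ∑ i ∈ Finset.range (n + 1), hazardWait H (startAge a i) (ω i)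

lemma renewalTime_zero (H : ℝ → ℝ) (a : ℝ) (ω : Sample) :
    renewalTime H 0 a ω = hazardWait H a (ω 0) := by
  simp [renewalTime, startAge]

lemma renewalTime_succ (H : ℝ → ℝ) (n : ℕ) (a : ℝ) (ω : Sample) :
    renewalTime H (n + 1) a ω = renewalTime H n a ω + hazardWait H 0 (ω (n + 1)) := by
  rw [renewalTime, Finset.sum_range_succ]
  rfl

/-- The law of the lifetime of a new item. -/
noncomputable def lifetimeLaw (H : ℝ → ℝ) : Measure ℝ := (expMeasure 1).map (hazardWait H 0)

/-- The survival function of a new item. -/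
noncomputable def survival (H : ℝ → ℝ) (t : ℝ) : ℝ≥0∞ := ENNReal.ofReal (Real.exp (-H t))

/-- The expectation of `g` after one more lifetime. -/
noncomputable def lifetimeShift (H : ℝ → ℝ) (g : ℝ → ℝ≥0∞) (s : ℝ) : ℝ≥0∞ :=
  ∫⁻ v, g (s + v) ∂lifetimeLaw H

open Classical in
/-- The value of `f` at the age at time `t` of the item then in use, when the initial item has
age `a`. -/
noncomputable def ageFunction (H : ℝ → ℝ) (f : ℝ → ℝ≥0∞) (t a : ℝ) (ω : Sample) : ℝ≥0∞ :=
  (if t < renewalTime H 0 a ω then f (a + t) else 0) +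
    ∑' n, if renewalTime H n a ω ≤ t ∧ t < renewalTime H (n + 1) a ω
      then f (t - renewalTime H n a ω) else 0

lemma setLIntegral_Ici_comp_add {f : ℝ → ℝ≥0∞} (hf : Measurable f) (t : ℝ) :
    ∫⁻ a in Ici 0, f (a + t) = ∫⁻ u in Ici t, f u := by
  rw [← (measurePreserving_add_right volume t).setLIntegral_comp_preimage measurableSet_Ici hf]
  congr 2
  ext a
  simp

lemma hazardWait_le {H : ℝ → ℝ} {a e t : ℝ} (ht : 0 ≤ t) (he : e ≤ H (a + t) - H a) :
    hazardWait H a e ≤ t :=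
  csInf_le ⟨0, fun _ hs => hs.1⟩ ⟨ht, he⟩

namespace IsHazard

variable {H : ℝ → ℝ} {c₁ c₂ : ℝ} (h : IsHazard H c₁ c₂)

include h

lemma mono : Monotone H := fun s t hst => by
  have := h.lower s t hst
  have := mul_nonneg h.pos.le (sub_nonneg.2 hst)
  linarith

lemma c₂_pos : 0 < c₂ := by
  have h1 := h.lower 0 1 zero_le_one
  have h2 := h.upper 0 1 zero_le_one
  have := h.pos
  linarith

lemma continuous : Continuous H := by
  refine (LipschitzWith.of_le_add_mul c₂.toNNReal fun s t => ?_).continuous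
  rw [Real.coe_toNNReal _ h.c₂_pos.le, Real.dist_eq]
  rcases le_total s t with hst | hst
  · have := h.mono hst
    have := mul_nonneg h.c₂_pos.le (abs_nonneg (s - t))
    linarith
  · have := h.upper t s hst
    rw [abs_of_nonneg (sub_nonneg.2 hst)]
    linarith

lemma measurable : Measurable H := h.continuous.measurable

/-- The infimum is attained: the set is closed, and the lower bound on the rate puts `max 0 (e /
c₁)` in it. -/
lemma wait_mem (a e : ℝ) :
    hazardWait H a e ∈ {t | 0 ≤ t ∧ e ≤ H (a + t) - H a} := by
  have hcl : IsClosed {t | 0 ≤ t ∧ e ≤ H (a + t) - H a} := by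
    have := h.continuous
    exact (isClosed_Ici (a := (0 : ℝ))).inter
      (isClosed_le continuous_const (by fun_prop : Continuous fun t => H (a + t) - H a))
  refine hcl.csInf_mem ⟨max 0 (e / c₁), le_max_left _ _, ?_⟩ ⟨0, fun t ht => ht.1⟩
  have h1 := h.lower a (a + max 0 (e / c₁)) (by simp)
  have h2 := mul_le_mul_of_nonneg_left (le_max_right 0 (e / c₁)) h.pos.le
  rw [mul_div_cancel₀ _ h.pos.ne'] at h2
  rw [add_sub_cancel_left] at h1
  linarith

lemma wait_nonneg (a e : ℝ) : 0 ≤ hazardWait H a e := (h.wait_mem a e).1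

/-- The waiting time is a generalized inverse of the hazard; its measurability and its law are both
read off from this equivalence. -/
lemma lt_wait_iff {a e t : ℝ} (ht : 0 ≤ t) : t < hazardWait H a e ↔ H (a + t) - H a < e := by
  refine ⟨fun hlt => ?_, fun hlt => ?_⟩
  · by_contra! hcon
    exact absurd (hazardWait_le ht hcon) (not_le.2 hlt)
  · by_contra! hcon
    have h1 := (h.wait_mem a e).2
    have h2 := h.mono (add_le_add_right hcon a)
    linarith

lemma wait_pos {a e : ℝ} (he : 0 < e) : 0 < hazardWait H a e := by
  rw [h.lt_wait_iff le_rfl]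
  simpa using he

/-- The upper bound on the rate keeps lifetimes from being too short; this is what prevents renewals
from accumulating. -/
lemma le_mul_wait_zero (e : ℝ) : e ≤ c₂ * hazardWait H 0 e := by
  have h1 := (h.wait_mem 0 e).2
  have h2 := h.upper 0 (0 + hazardWait H 0 e) (by simpa using h.wait_nonneg 0 e)
  rw [zero_add, sub_zero] at h2
  rw [zero_add] at h1
  linarith

lemma measurable_wait : Measurable fun z : ℝ × ℝ => hazardWait H z.1 z.2 := by
  refine measurable_of_Ioi fun t => ?_
  have hm := h.measurable
  rcases lt_or_ge t 0 with ht | ht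
  · convert MeasurableSet.univ
    rw [eq_univ_iff_forall]
    exact fun z => ht.trans_le (h.wait_nonneg _ _)
  · have : (fun z : ℝ × ℝ => hazardWait H z.1 z.2) ⁻¹' Ioi t =
        {z | H (z.1 + t) - H z.1 < z.2} := by
      ext z
      exact h.lt_wait_iff ht
    rw [this]
    exact measurableSet_lt (by fun_prop) measurable_snd

lemma measurable_wait_left (a : ℝ) : Measurable (hazardWait H a) :=
  h.measurable_wait.comp measurable_prodMk_left

lemma measurable_renewalTime (n : ℕ) :
    Measurable fun z : ℝ × Sample => renewalTime H n z.1 z.2 := by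
  unfold renewalTime
  refine Finset.measurable_sum _ fun i _ => ?_
  have h1 : Measurable fun z : ℝ × Sample => startAge z.1 i := by
    cases i with
    | zero => exact measurable_fst
    | succ n => exact measurable_const
  exact h.measurable_wait.comp (h1.prodMk ((measurable_pi_apply i).comp measurable_snd))

lemma measurable_renewalTime_left (n : ℕ) (a : ℝ) : Measurable (renewalTime H n a) :=
  Finset.measurable_fun_sum _ fun i _ =>
    (h.measurable_wait_left (startAge a i)).comp (measurable_pi_apply i)

lemma measurable_survival : Measurable (survival H) := by
  have := h.measurable
  unfold survival
  fun_prop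

lemma isProbabilityMeasure_lifetimeLaw : IsProbabilityMeasure (lifetimeLaw H) :=
  Measure.isProbabilityMeasure_map (h.measurable_wait_left 0).aemeasurable

lemma expMeasure_wait_gt {a t : ℝ} (ht : 0 ≤ t) :
    expMeasure 1 {e | t < hazardWait H a e} =
      ENNReal.ofReal (Real.exp (-(H (a + t) - H a))) := by
  have : {e | t < hazardWait H a e} = Ioi (H (a + t) - H a) := by
    ext e
    exact h.lt_wait_iff ht
  rw [this, expMeasure_one_Ioi (sub_nonneg.2 (h.mono (by linarith)))]

lemma lifetimeLaw_Ioi {t : ℝ} (ht : 0 ≤ t) : lifetimeLaw H (Ioi t) = survival H t := by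
  rw [lifetimeLaw, Measure.map_apply (h.measurable_wait_left 0) measurableSet_Ioi]
  have := h.expMeasure_wait_gt (a := 0) ht
  rw [zero_add, h.zero, sub_zero] at this
  exact this

lemma ae_lifetimeLaw_nonneg : ∀ᵐ v ∂lifetimeLaw H, 0 ≤ v :=
  (ae_map_iff (h.measurable_wait_left 0).aemeasurable measurableSet_Ici).2
    (Filter.Eventually.of_forall fun e => h.wait_nonneg 0 e)

lemma measurable_lifetimeShift {g : ℝ → ℝ≥0∞} (hg : Measurable g) :
    Measurable (lifetimeShift H g) := by
  have := h.isProbabilityMeasure_lifetimeLaw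
  unfold lifetimeShift
  exact (by fun_prop : Measurable fun z : ℝ × ℝ => g (z.1 + z.2)).lintegral_prod_right'

/-- The lifetime of the next item is independent of the renewals so far. -/
lemma lintegral_renewalTime_prod (n : ℕ) (a : ℝ) {g : ℝ × ℝ → ℝ≥0∞} (hg : Measurable g) :
    ∫⁻ ω, g (renewalTime H n a ω, hazardWait H 0 (ω (n + 1))) ∂sampleMeasure =
      ∫⁻ ω, ∫⁻ v, g (renewalTime H n a ω, v) ∂lifetimeLaw H ∂sampleMeasure := by
  have := h.isProbabilityMeasure_lifetimeLaw
  have hmw : ∀ i, Measurable (hazardWait H (startAge a i)) := fun i => h.measurable_wait_left _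
  have hindep : iIndepFun (fun (i : ℕ) (ω : Sample) => hazardWait H (startAge a i) (ω i))
      sampleMeasure := iIndepFun_infinitePi (P := fun _ : ℕ => expMeasure 1) hmw
  have h2 := hindep.indepFun_finsetSum_of_notMem
    (fun i => (hmw i).comp (measurable_pi_apply i)) (Finset.notMem_range_self (n := n + 1))
  have h3 : (∑ j ∈ Finset.range (n + 1), fun ω : Sample => hazardWait H (startAge a j) (ω j)) =
      renewalTime H n a := by
    ext ω
    simp [renewalTime]
  rw [h3] at h2
  have hm1 := h.measurable_renewalTime_left n a
  have hm2 : Measurable fun ω : Sample => hazardWait H 0 (ω (n + 1)) :=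
    (h.measurable_wait_left 0).comp (measurable_pi_apply _)
  have h4 := h2.map_prod_eq_prod_map_map hm1.aemeasurable hm2.aemeasurable
  have h5 : sampleMeasure.map (fun ω : Sample => hazardWait H 0 (ω (n + 1))) = lifetimeLaw H := by
    have : (fun ω : Sample => hazardWait H 0 (ω (n + 1))) =
        hazardWait H 0 ∘ fun ω : Sample => ω (n + 1) := rfl
    rw [this, ← Measure.map_map (h.measurable_wait_left 0) (measurable_pi_apply _), sampleMeasure,
      Measure.infinitePi_map_eval (fun _ : ℕ => expMeasure 1), lifetimeLaw]
  rw [h5] at h4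
  have h7 : ∫⁻ ω, g (renewalTime H n a ω, hazardWait H 0 (ω (n + 1))) ∂sampleMeasure =
      ∫⁻ z, g z ∂(sampleMeasure.map
        fun ω => (renewalTime H n a ω, hazardWait H 0 (ω (n + 1)))) :=
    (lintegral_map hg (hm1.prodMk hm2)).symm
  rw [h7, h4, lintegral_prod _ hg.aemeasurable, lintegral_map hg.lintegral_prod_right' hm1]

lemma lintegral_renewalTime_succ (n : ℕ) (a : ℝ) {g : ℝ → ℝ≥0∞} (hg : Measurable g) :
    ∫⁻ ω, g (renewalTime H (n + 1) a ω) ∂sampleMeasure =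
      ∫⁻ ω, lifetimeShift H g (renewalTime H n a ω) ∂sampleMeasure := by
  simp only [renewalTime_succ]
  exact h.lintegral_renewalTime_prod n a (g := fun z => g (z.1 + z.2)) (by fun_prop)

/-- Only the first renewal depends on the initial age; the later lifetimes are i.i.d. and become
powers of one operator. -/
lemma lintegral_renewalTime_eq_iterate (n : ℕ) (a : ℝ) {g : ℝ → ℝ≥0∞} (hg : Measurable g) :
    ∫⁻ ω, g (renewalTime H n a ω) ∂sampleMeasure =
      ∫⁻ ω, (lifetimeShift H)^[n] g (renewalTime H 0 a ω) ∂sampleMeasure := by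
  induction n generalizing g with
  | zero => rfl
  | succ n ih =>
    rw [h.lintegral_renewalTime_succ n a hg, ih (h.measurable_lifetimeShift hg)]
    rfl

lemma measurable_iterate_lifetimeShift (n : ℕ) {g : ℝ → ℝ≥0∞} (hg : Measurable g) :
    Measurable ((lifetimeShift H)^[n] g) := by
  induction n generalizing g with
  | zero => exact hg
  | succ n ih => exact ih (h.measurable_lifetimeShift hg)

omit h in
lemma iterate_lifetimeShift_mono (n : ℕ) {f g : ℝ → ℝ≥0∞} (hfg : f ≤ g) :
    (lifetimeShift H)^[n] f ≤ (lifetimeShift H)^[n] g := by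
  induction n generalizing f g with
  | zero => exact hfg
  | succ n ih => exact ih fun s => lintegral_mono fun v => hfg _

/-- Exponentials are contracted by `lifetimeShift`. -/
lemma exists_iterate_lifetimeShift_exp_le : ∃ ρ : ℝ≥0∞, ρ < 1 ∧ ∀ (t : ℝ) (n : ℕ) (s : ℝ),
    (lifetimeShift H)^[n] (fun s => ENNReal.ofReal (Real.exp (c₂ * (t - s)))) s ≤
      ρ ^ n * ENNReal.ofReal (Real.exp (c₂ * (t - s))) := by
  have := h.isProbabilityMeasure_lifetimeLaw
  -- The contraction factor is the Laplace transform of the lifetime at `c₂`, less than one because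
  -- lifetimes are almost surely positive.
  refine ⟨∫⁻ v, ENNReal.ofReal (Real.exp (-(c₂ * v))) ∂lifetimeLaw H, ?_, fun t n => ?_⟩
  · have hmw := h.measurable_wait_left 0
    have hone : ∫⁻ _ : ℝ, (1 : ℝ≥0∞) ∂expMeasure 1 = 1 := by simp
    rw [lifetimeLaw, lintegral_map (by fun_prop) hmw]
    conv_rhs => rw [← hone]
    have hpos : ∀ᵐ e ∂expMeasure 1, 0 < e := by
      rw [ae_iff]
      have := expMeasure_one_Iic 0
      simpa [Iic] using this
    have hlt : ∀ᵐ e ∂expMeasure 1,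
        ENNReal.ofReal (Real.exp (-(c₂ * hazardWait H 0 e))) < 1 := by
      filter_upwards [hpos] with e he
      rw [ENNReal.ofReal_lt_one, Real.exp_lt_one_iff]
      linarith [h.le_mul_wait_zero e]
    refine lintegral_strict_mono (IsProbabilityMeasure.ne_zero _) aemeasurable_const ?_ hlt
    refine ((lintegral_mono_ae (hlt.mono fun e he => he.le)).trans_lt ?_).ne
    rw [hone]
    exact ENNReal.one_lt_top
  · induction n with
    | zero =>
      intro s
      simp
    | succ n ih =>
      intro s
      rw [Function.iterate_succ_apply', pow_succ', mul_assoc]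
      refine (lintegral_mono fun v => ih (s + v)).trans ?_
      have : ∀ v, ENNReal.ofReal (Real.exp (c₂ * (t - (s + v)))) =
          ENNReal.ofReal (Real.exp (-(c₂ * v))) * ENNReal.ofReal (Real.exp (c₂ * (t - s))) := by
        intro v
        rw [← ENNReal.ofReal_mul (Real.exp_pos _).le, ← Real.exp_add]
        ring_nf
      simp only [this, ← mul_assoc, mul_comm (_ ^ n)]
      rw [lintegral_mul_const _ (by fun_prop), lintegral_mul_const _ (by fun_prop)]

/-- Almost surely, there are only finitely many renewals in bounded time. -/
lemma ae_exists_lt_renewalTime (a t : ℝ) :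
    ∀ᵐ ω ∂sampleMeasure, ∃ n, t < renewalTime H n a ω := by
  obtain ⟨ρ, hρ, hle⟩ := h.exists_iterate_lifetimeShift_exp_le
  rw [ae_iff]
  simp only [not_exists, not_lt]
  -- Chernoff bound: the indicator of `s ≤ t` is at most `exp (c₂ (t - s))`, which the operator
  -- contracts.
  have hbound : ∀ n, sampleMeasure {ω | ∀ n, renewalTime H n a ω ≤ t} ≤
      ρ ^ n * ENNReal.ofReal (Real.exp (c₂ * t)) := by
    intro n
    have hm : Measurable fun s => ENNReal.ofReal (Real.exp (c₂ * (t - s))) := by fun_prop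
    calc sampleMeasure {ω | ∀ n, renewalTime H n a ω ≤ t}
        ≤ sampleMeasure {ω | renewalTime H n a ω ≤ t} := measure_mono fun ω hω => hω n
      _ = ∫⁻ ω, {ω | renewalTime H n a ω ≤ t}.indicator 1 ω ∂sampleMeasure := by
          rw [lintegral_indicator_one
            (measurableSet_le (h.measurable_renewalTime_left n a) measurable_const)]
      _ ≤ ∫⁻ ω, ENNReal.ofReal (Real.exp (c₂ * (t - renewalTime H n a ω))) ∂sampleMeasure := by
          refine lintegral_mono fun ω => ?_
          by_cases hω : renewalTime H n a ω ≤ t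
          swap
          · rw [indicator_of_notMem (by exact hω)]
            exact zero_le
          rw [indicator_of_mem (by exact hω), Pi.one_apply, ENNReal.one_le_ofReal, Real.one_le_exp_iff]
          exact mul_nonneg h.c₂_pos.le (sub_nonneg.2 hω)
      _ = ∫⁻ ω, (lifetimeShift H)^[n] (fun s => ENNReal.ofReal (Real.exp (c₂ * (t - s))))
            (renewalTime H 0 a ω) ∂sampleMeasure := h.lintegral_renewalTime_eq_iterate n a hm
      _ ≤ ∫⁻ _, ρ ^ n * ENNReal.ofReal (Real.exp (c₂ * t)) ∂sampleMeasure := by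
          refine lintegral_mono fun ω => (hle t n _).trans ?_
          have h0 := h.wait_nonneg a (ω 0)
          have := h.c₂_pos
          rw [renewalTime_zero]
          gcongr
          linarith
      _ = ρ ^ n * ENNReal.ofReal (Real.exp (c₂ * t)) := by simp
  have hlim : Filter.Tendsto (fun n : ℕ => ρ ^ n * ENNReal.ofReal (Real.exp (c₂ * t)))
      Filter.atTop (nhds 0) := by
    have := ENNReal.Tendsto.mul_const (b := ENNReal.ofReal (Real.exp (c₂ * t)))
      (ENNReal.tendsto_pow_atTop_nhds_zero_of_lt_one hρ) (Or.inr ENNReal.ofReal_ne_top)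
    rwa [zero_mul] at this
  exact le_antisymm (ge_of_tendsto' hlim hbound) zero_le

lemma lintegral_survival_lt_top : ∫⁻ a in Ici 0, survival H a < ∞ := by
  have h1 : ∫⁻ a in Ici (0 : ℝ), ENNReal.ofReal (Real.exp (-c₁ * a)) < ∞ := by
    rw [setLIntegral_congr Ioi_ae_eq_Ici.symm]
    exact (integrableOn_exp_mul_Ioi (neg_lt_zero.2 h.pos) 0).setLIntegral_lt_top
  refine lt_of_le_of_lt (setLIntegral_mono (by fun_prop) fun a ha => ?_) h1
  have := h.lower 0 a ha
  rw [h.zero] at this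
  exact ENNReal.ofReal_le_ofReal (Real.exp_le_exp.2 (by linarith))

/-- Under the equilibrium age distribution, the first renewal time has that distribution too. -/
lemma lintegral_first_renewal {g : ℝ → ℝ≥0∞} (hg : Measurable g) :
    ∫⁻ a in Ici 0, survival H a * ∫⁻ ω, g (renewalTime H 0 a ω) ∂sampleMeasure =
      ∫⁻ s in Ici 0, survival H s * g s := by
  have hS := h.measurable_survival
  set ν : Measure ℝ := (volume.restrict (Ici 0)).withDensity (survival H) with hν
  have hfin : IsFiniteMeasure ν := isFiniteMeasure_withDensity h.lintegral_survival_lt_top.ne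
  set α : Measure ℝ := (ν.prod (expMeasure 1)).map (fun z => hazardWait H z.1 z.2) with hα
  have hαap : ∀ B, MeasurableSet B → α B =
      ∫⁻ a in Ici 0, survival H a * expMeasure 1 (hazardWait H a ⁻¹' B) := by
    intro B hB
    rw [hα, Measure.map_apply h.measurable_wait hB, Measure.prod_apply (h.measurable_wait hB), hν,
      lintegral_withDensity_eq_lintegral_mul _ hS
        (measurable_measure_prodMk_left (h.measurable_wait hB))]
    rfl
  have hνap : ∀ B, MeasurableSet B → ν B = ∫⁻ a in B ∩ Ici 0, survival H a := by
    intro B hB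
    rw [hν, withDensity_apply _ hB, Measure.restrict_restrict hB]
  have huniv : α univ = ν univ := by
    rw [hαap _ MeasurableSet.univ, hνap _ MeasurableSet.univ]
    simp
  -- It suffices to compare half-lines. An item of age `a` survives another `t` with probability
  -- `exp (-(H (a + t) - H a))`; the weight `exp (-H a)` turns this into `exp (-H (a + t))`, and
  -- integrating over `a ≥ 0` gives the tail of `ν`.
  have heq : α = ν := by
    have : IsFiniteMeasure α := ⟨by rw [huniv]; exact measure_lt_top _ _⟩
    refine ext_of_generate_finite (range Ioi)
      (BorelSpace.measurable_eq.trans (borel_eq_generateFrom_Ioi ℝ)) isPiSystem_Ioi ?_ huniv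
    rintro _ ⟨t, rfl⟩
    rw [hαap _ measurableSet_Ioi, hνap _ measurableSet_Ioi]
    rcases lt_or_ge t 0 with ht | ht
    · rw [inter_eq_right.2 (Ici_subset_Ioi.2 ht)]
      refine setLIntegral_congr_fun measurableSet_Ici fun a _ => ?_
      have : hazardWait H a ⁻¹' Ioi t = univ :=
        eq_univ_of_forall fun e => ht.trans_le (h.wait_nonneg a e)
      simp [this]
    · rw [inter_eq_left.2 (Ioi_subset_Ici ht), setLIntegral_congr Ioi_ae_eq_Ici,
        ← setLIntegral_Ici_comp_add hS]
      refine setLIntegral_congr_fun measurableSet_Ici fun a _ => ?_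
      have := h.expMeasure_wait_gt (a := a) ht
      simp only [survival]
      rw [show hazardWait H a ⁻¹' Ioi t = {e | t < hazardWait H a e} from rfl, this,
        ← ENNReal.ofReal_mul (Real.exp_pos _).le, ← Real.exp_add]
      ring_nf
  have hR : ∫⁻ s, g s ∂ν = ∫⁻ s in Ici 0, survival H s * g s :=
    lintegral_withDensity_eq_lintegral_mul _ hS hg
  have hgw : Measurable fun z : ℝ × ℝ => g (hazardWait H z.1 z.2) := hg.comp h.measurable_wait
  rw [← hR, ← heq, hα, lintegral_map hg h.measurable_wait, lintegral_prod _ hgw.aemeasurable, hν,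
    lintegral_withDensity_eq_lintegral_mul _ hS hgw.lintegral_prod_right']
  refine lintegral_congr fun a => ?_
  rw [Pi.mul_apply]
  congr 1
  simp only [renewalTime_zero]
  have hmp := measurePreserving_eval_infinitePi (fun _ : ℕ => expMeasure 1) 0
  exact hmp.lintegral_comp (hg.comp (h.measurable_wait_left a))

/-- The renewal equation of Lebesgue measure on the half-line. -/
lemma lintegral_Ici_eq_add {g : ℝ → ℝ≥0∞} (hg : Measurable g) :
    ∫⁻ s in Ici 0, g s =
      (∫⁻ s in Ici 0, survival H s * g s) + ∫⁻ s in Ici 0, lifetimeShift H g s := by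
  have := h.isProbabilityMeasure_lifetimeLaw
  have hS := h.measurable_survival
  -- By Tonelli, starting points `s ≥ 0` with `s + v = u` exist exactly when `v ≤ u`, so the shift
  -- weights `g u` by the distribution function, which complements the survival function.
  have h1 : ∫⁻ s in Ici 0, lifetimeShift H g s =
      ∫⁻ u in Ici 0, lifetimeLaw H (Iic u) * g u := by
    unfold lifetimeShift
    rw [lintegral_lintegral_swap (by fun_prop)]
    have : ∀ᵐ v ∂lifetimeLaw H, ∫⁻ s in Ici 0, g (s + v) =
        ∫⁻ u in Ici 0, (Iic u).indicator (fun _ => g u) v := by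
      filter_upwards [h.ae_lifetimeLaw_nonneg] with v hv
      rw [setLIntegral_Ici_comp_add hg]
      have : ∀ u, (Iic u).indicator (fun _ => g u) v = (Ici v).indicator g u := fun u => by
        simp [indicator]
      simp only [this]
      rw [lintegral_indicator measurableSet_Ici, Measure.restrict_restrict measurableSet_Ici,
        inter_eq_left.2 (Ici_subset_Ici.2 hv)]
    rw [lintegral_congr_ae this, lintegral_lintegral_swap]
    · refine lintegral_congr fun u => ?_
      rw [lintegral_indicator_const measurableSet_Iic, mul_comm]
    · have hset : MeasurableSet {z : ℝ × ℝ | z.1 ≤ z.2} := measurableSet_le' 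
      exact ((hg.comp measurable_snd).indicator hset).aemeasurable
  have hmI : Measurable fun u => lifetimeLaw H (Iic u) :=
    (Monotone.measurable fun u v huv => measure_mono (Iic_subset_Iic.2 huv))
  have hSg : Measurable fun u => survival H u * g u := hS.mul hg
  rw [h1, ← lintegral_add_left hSg]
  refine setLIntegral_congr_fun measurableSet_Ici fun u hu => ?_
  rw [← h.lifetimeLaw_Ioi hu, ← add_mul, ← compl_Iic, add_comm,
    measure_add_measure_compl measurableSet_Iic, measure_univ, one_mul]

/-- Under the equilibrium age distribution, the mean number of renewals is proportional to
time. -/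
lemma tsum_lintegral_renewalTime {g : ℝ → ℝ≥0∞} (hg : Measurable g) {t : ℝ}
    (hgt : ∀ s, t < s → g s = 0) (hg1 : ∀ s, g s ≤ 1) :
    ∑' n, ∫⁻ a in Ici 0, survival H a * ∫⁻ ω, g (renewalTime H n a ω) ∂sampleMeasure =
      ∫⁻ s in Ici 0, g s := by
  obtain ⟨ρ, hρ, hle⟩ := h.exists_iterate_lifetimeShift_exp_le
  have hm := fun n => h.measurable_iterate_lifetimeShift n hg
  have hterm : ∀ n, ∫⁻ a in Ici 0, survival H a * ∫⁻ ω, g (renewalTime H n a ω) ∂sampleMeasure =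
      ∫⁻ s in Ici 0, survival H s * (lifetimeShift H)^[n] g s := fun n => by
    simp only [h.lintegral_renewalTime_eq_iterate n _ hg]
    exact h.lintegral_first_renewal (hm n)
  simp only [hterm]
  -- The renewal equation iterated `N` times; the remainder vanishes geometrically, since `g` lies
  -- below a contracted exponential.
  have hpartial : ∀ N, ∫⁻ s in Ici 0, g s =
      (∑ n ∈ Finset.range N, ∫⁻ s in Ici 0, survival H s * (lifetimeShift H)^[n] g s) +
        ∫⁻ s in Ici 0, (lifetimeShift H)^[N] g s := by
    intro N
    induction N with
    | zero => simp
    | succ N ih =>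
      rw [ih, h.lintegral_Ici_eq_add (hm N), Finset.sum_range_succ, add_assoc,
        ← Function.iterate_succ_apply' (lifetimeShift H)]
  have hgexp : g ≤ fun s => ENNReal.ofReal (Real.exp (c₂ * (t - s))) := fun s => by
    rcases lt_or_ge t s with hs | hs
    · rw [hgt s hs]
      exact zero_le
    · refine (hg1 s).trans ?_
      rw [ENNReal.one_le_ofReal, Real.one_le_exp_iff]
      exact mul_nonneg h.c₂_pos.le (sub_nonneg.2 hs)
  set I := ∫⁻ s in Ici (0 : ℝ), ENNReal.ofReal (Real.exp (c₂ * (t - s))) with hI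
  have hIfin : I ≠ ∞ := by
    have h1 : IntegrableOn (fun s => Real.exp (c₂ * t) * Real.exp (-c₂ * s)) (Ioi (0 : ℝ)) :=
      (integrableOn_exp_mul_Ioi (neg_lt_zero.2 h.c₂_pos) 0).const_mul _
    rw [hI, setLIntegral_congr Ioi_ae_eq_Ici.symm]
    refine (lt_of_eq_of_lt (lintegral_congr fun s => ?_) h1.setLIntegral_lt_top).ne
    rw [← Real.exp_add]
    ring_nf
  have hrest : ∀ N, ∫⁻ s in Ici 0, (lifetimeShift H)^[N] g s ≤ ρ ^ N * I := by
    intro N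
    rw [hI, ← lintegral_const_mul _ (by fun_prop)]
    exact lintegral_mono fun s => (iterate_lifetimeShift_mono N hgexp s).trans (hle t N s)
  have hlim : Filter.Tendsto (fun N : ℕ => ρ ^ N * I) Filter.atTop (nhds 0) := by
    have := ENNReal.Tendsto.mul_const (b := I)
      (ENNReal.tendsto_pow_atTop_nhds_zero_of_lt_one hρ) (Or.inr hIfin)
    rwa [zero_mul] at this
  have hlim' : Filter.Tendsto (fun N : ℕ => ∫⁻ s in Ici 0, (lifetimeShift H)^[N] g s)
      Filter.atTop (nhds 0) :=
    tendsto_of_tendsto_of_tendsto_of_le_of_le tendsto_const_nhds hlim (fun _ => zero_le) hrest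
  have hsum := (ENNReal.tendsto_nat_tsum fun n =>
    ∫⁻ s in Ici 0, survival H s * (lifetimeShift H)^[n] g s).add hlim'
  simp only [← hpartial, add_zero] at hsum
  exact tendsto_nhds_unique hsum tendsto_const_nhds

lemma measurable_ageFunction {f : ℝ → ℝ≥0∞} (hf : Measurable f) (t : ℝ) :
    Measurable fun z : ℝ × Sample => ageFunction H f t z.1 z.2 := by
  have hm := h.measurable_renewalTime
  unfold ageFunction
  refine (Measurable.ite (measurableSet_lt measurable_const (hm 0)) (by fun_prop)
    measurable_const).add (Measurable.tsum fun n => ?_)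
  have h1 := hm n
  exact Measurable.ite ((measurableSet_le h1 measurable_const).inter
    (measurableSet_lt measurable_const (hm (n + 1)))) (by fun_prop) measurable_const

lemma measurable_ageFunction_left {f : ℝ → ℝ≥0∞} (hf : Measurable f) (t a : ℝ) :
    Measurable (ageFunction H f t a) := by
  have hm := fun n => h.measurable_renewalTime_left n a
  unfold ageFunction
  refine (Measurable.ite (measurableSet_lt measurable_const (hm 0)) measurable_const
    measurable_const).add (Measurable.tsum fun n => ?_)
  have h1 := hm n
  exact Measurable.ite ((measurableSet_le h1 measurable_const).inter
    (measurableSet_lt measurable_const (hm (n + 1)))) (by fun_prop) measurable_const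

/-- The age distribution with density proportional to the survival function is stationary. -/
theorem lintegral_age {f : ℝ → ℝ≥0∞} (hf : Measurable f) (hf1 : ∀ a, f a ≤ 1) {t : ℝ}
    (ht : 0 ≤ t) :
    ∫⁻ a in Ici 0, survival H a * ∫⁻ ω, ageFunction H f t a ω ∂sampleMeasure =
      ∫⁻ a in Ici 0, survival H a * f a := by
  unfold ageFunction
  have hS := h.measurable_survival
  have := h.isProbabilityMeasure_lifetimeLaw
  -- Given a renewal at `s ≤ t`, it is the last one before `t` if the next lifetime exceeds `t - s`;
  -- `g` is the expectation over that lifetime.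
  set g : ℝ → ℝ≥0∞ := fun s => if s ≤ t then survival H (t - s) * f (t - s) else 0 with hgdef
  have hg : Measurable g := Measurable.ite measurableSet_Iic (by fun_prop) measurable_const
  have hS1 : ∀ u, 0 ≤ u → survival H u ≤ 1 := fun u hu => by
    have := h.mono hu
    rw [h.zero] at this
    rw [survival, ENNReal.ofReal_le_one, Real.exp_le_one_iff]
    linarith
  have hfirst : ∀ a, ∫⁻ ω, (if t < renewalTime H 0 a ω then f (a + t) else 0) ∂sampleMeasure =
      f (a + t) * ENNReal.ofReal (Real.exp (-(H (a + t) - H a))) := by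
    intro a
    have hms : MeasurableSet {e | t < hazardWait H a e} :=
      measurableSet_lt measurable_const (h.measurable_wait_left a)
    have hmp := measurePreserving_eval_infinitePi (fun _ : ℕ => expMeasure 1) 0
    simp only [renewalTime_zero]
    rw [← h.expMeasure_wait_gt ht, ← lintegral_indicator_const hms]
    exact hmp.lintegral_comp (measurable_const.indicator hms)
  have hterm : ∀ a n, ∫⁻ ω, (if renewalTime H n a ω ≤ t ∧ t < renewalTime H (n + 1) a ω
      then f (t - renewalTime H n a ω) else 0) ∂sampleMeasure =
      ∫⁻ ω, g (renewalTime H n a ω) ∂sampleMeasure := by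
    intro a n
    simp only [renewalTime_succ]
    have hms : MeasurableSet {z : ℝ × ℝ | z.1 ≤ t ∧ t < z.1 + z.2} :=
      (measurableSet_le measurable_fst measurable_const).inter
        (measurableSet_lt measurable_const (measurable_fst.add measurable_snd))
    rw [h.lintegral_renewalTime_prod n a
      (g := fun z => if z.1 ≤ t ∧ t < z.1 + z.2 then f (t - z.1) else 0)
      (Measurable.ite hms (by fun_prop) measurable_const)]
    refine lintegral_congr fun ω => ?_
    simp only [hgdef]
    split_ifs with hle
    · have h0 : 0 ≤ t - renewalTime H n a ω := sub_nonneg.2 hle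
      rw [← h.lifetimeLaw_Ioi h0, mul_comm, ← lintegral_indicator_const measurableSet_Ioi]
      refine lintegral_congr fun v => ?_
      simp [indicator, hle, sub_lt_iff_lt_add']
    · simp [hle]
  have hsplit : ∀ a, survival H a *
      ∫⁻ ω, ((if t < renewalTime H 0 a ω then f (a + t) else 0) +
        ∑' n, if renewalTime H n a ω ≤ t ∧ t < renewalTime H (n + 1) a ω
          then f (t - renewalTime H n a ω) else 0) ∂sampleMeasure =
      survival H (a + t) * f (a + t) +
        ∑' n, survival H a * ∫⁻ ω, g (renewalTime H n a ω) ∂sampleMeasure := by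
    intro a
    have h1 : Measurable fun ω => if t < renewalTime H 0 a ω then f (a + t) else 0 :=
      Measurable.ite (measurableSet_lt measurable_const (h.measurable_renewalTime_left 0 a))
        measurable_const measurable_const
    have h2 : ∀ n, Measurable fun ω =>
        if renewalTime H n a ω ≤ t ∧ t < renewalTime H (n + 1) a ω
        then f (t - renewalTime H n a ω) else 0 := fun n => by
      have h3 := h.measurable_renewalTime_left n a
      have h4 := h.measurable_renewalTime_left (n + 1) a
      exact Measurable.ite ((measurableSet_le h3 measurable_const).inter
        (measurableSet_lt measurable_const h4)) (by fun_prop) measurable_const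
    rw [lintegral_add_left h1, hfirst, lintegral_tsum fun n => (h2 n).aemeasurable, mul_add,
      ENNReal.tsum_mul_left]
    simp only [hterm]
    congr 1
    rw [mul_comm (f _), ← mul_assoc, survival, survival,
      ← ENNReal.ofReal_mul (Real.exp_pos _).le, ← Real.exp_add]
    ring_nf
  simp only [hsplit]
  have hmg : ∀ n, Measurable fun a => survival H a *
      ∫⁻ ω, g (renewalTime H n a ω) ∂sampleMeasure := fun n =>
    hS.mul (hg.comp (h.measurable_renewalTime n)).lintegral_prod_right'
  have hmSf : Measurable fun u => survival H u * f u := hS.mul hf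
  rw [lintegral_add_left (by fun_prop), lintegral_tsum fun n => (hmg n).aemeasurable,
    h.tsum_lintegral_renewalTime hg (t := t), setLIntegral_Ici_comp_add hmSf]
  -- Renewed items supply the ages up to `t`, items not yet renewed the ages beyond `t`; both carry
  -- the same density.
  · have h1 : ∫⁻ s in Ici 0, g s = ∫⁻ u in Icc 0 t, survival H u * f u := by
      have hsub := (Measure.measurePreserving_sub_left volume t).setLIntegral_comp_preimage
        (measurableSet_Icc (a := (0 : ℝ)) (b := t)) hmSf
      have hpre : (fun s => t - s) ⁻¹' Icc 0 t = Icc 0 t := by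
        ext s
        simp [and_comm]
      rw [← hsub, hpre, ← lintegral_indicator measurableSet_Ici,
        ← lintegral_indicator measurableSet_Icc]
      refine lintegral_congr fun s => ?_
      by_cases h0 : 0 ≤ s <;> by_cases hst : s ≤ t <;> simp [indicator, hgdef, h0, hst]
    rw [h1, add_comm, ← setLIntegral_congr (Ioi_ae_eq_Ici (a := t)),
      ← lintegral_union measurableSet_Ioi]
    · rw [Icc_union_Ioi_eq_Ici ht]
    · rw [disjoint_left]
      exact fun s hs hs' => absurd hs.2 (not_le.2 hs')
  · exact fun s hs => if_neg (not_le.2 hs)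
  · intro s
    simp only [hgdef]
    split_ifs with hs
    · exact mul_le_one' (hS1 _ (sub_nonneg.2 hs)) (hf1 _)
    · exact zero_le_one

end IsHazard

/-! ### The belief as a function of the time since the last detection -/

lemma Model.IsBeliefPath.shift {p : ℝ} {φ : ℝ → ℝ} (h : M.IsBeliefPath x y p φ) {a : ℝ}
    (ha : 0 ≤ a) : M.IsBeliefPath x y (φ a) fun t => φ (a + t) := by
  refine ⟨h.1.comp (by fun_prop) fun t ht => add_nonneg ha ht, fun t ht => ?_⟩
  have hat := add_nonneg ha ht
  refine ⟨h.mem hat, ?_, ?_⟩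
  · have h1 := (h.intervalIntegrable ha hat).comp_add_left a
    simpa using h1
  · have h1 := h.sub_eq ha hat
    have h2 := intervalIntegral.integral_comp_add_left (a := 0) (b := t)
      (fun s => M.drift x (φ s) (y (φ s))) a
    rw [add_zero] at h2
    rw [h2, ← h1]
    ring

/-- The trajectory `φ` of the belief from one has detection rate `η` and cumulative detection
rate `H`. -/
structure IsRegeneration (M : Model) (x : ℝ) (y φ η H : ℝ → ℝ) (c₁ c₂ : ℝ) : Prop where
  path : M.IsBeliefPath x y 1 φ
  intervalIntegrable : ∀ s t, IntervalIntegrable η volume s t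
  rate : ∀ s, 0 ≤ s → M.detectionRate x (φ s) (y (φ s)) = η s
  cumulative : ∀ t, H t = ∫ s in (0 : ℝ)..t, η s
  hazard : IsHazard H c₁ c₂

namespace IsRegeneration

variable {φ η H : ℝ → ℝ} {c₁ c₂ : ℝ} (h : IsRegeneration M x y φ η H c₁ c₂)
  (hadm : M.Admissible x y)

include h hadm

/-- Uniqueness of trajectories makes the belief `φ a` equivalent to age `a`, even where `φ` is not
injective. -/
lemma beliefPath_eq {a t : ℝ} (ha : 0 ≤ a) (ht : 0 ≤ t) :
    M.beliefPath x y (φ a) t = φ (a + t) :=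
  hadm.beliefPath_eq (h.path.mem ha) (h.path.shift ha) ht

lemma cumulativeRate_eq {a t : ℝ} (ha : 0 ≤ a) (ht : 0 ≤ t) :
    M.cumulativeRate x y (φ a) t = H (a + t) - H a := by
  rw [h.cumulative, h.cumulative, intervalIntegral.integral_interval_sub_left
    (h.intervalIntegrable _ _) (h.intervalIntegrable _ _)]
  have h2 := intervalIntegral.integral_comp_add_left (a := 0) (b := t) η a
  rw [add_zero] at h2
  rw [← h2, Model.cumulativeRate]
  refine intervalIntegral.integral_congr fun s hs => ?_
  rw [uIcc_of_le ht] at hs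
  simp only [h.beliefPath_eq hadm ha hs.1]
  exact h.rate _ (add_nonneg ha hs.1)

lemma waitingTime_eq {a : ℝ} (ha : 0 ≤ a) (e : ℝ) :
    M.waitingTime x y (φ a) e = ENNReal.ofReal (hazardWait H a e) := by
  refine le_antisymm ?_ (le_iInf₂ fun t ht => ENNReal.ofReal_le_ofReal ?_)
  · have h1 := h.hazard.wait_mem a e
    refine iInf₂_le _ ⟨h1.1, ?_⟩
    rw [h.cumulativeRate_eq hadm ha h1.1]
    exact h1.2
  · refine hazardWait_le ht.1 ?_
    rw [← h.cumulativeRate_eq hadm ha ht.1]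
    exact ht.2

lemma detectionTime_eq {a : ℝ} (ha : 0 ≤ a) (ω : Sample) (n : ℕ) :
    M.detectionTime x y (φ a) ω n = ENNReal.ofReal (renewalTime H n a ω) := by
  have hnn : ∀ n, 0 ≤ renewalTime H n a ω := fun n =>
    Finset.sum_nonneg fun i _ => h.hazard.wait_nonneg _ _
  induction n with
  | zero => rw [renewalTime_zero, ← h.waitingTime_eq hadm ha, Model.detectionTime]
  | succ n ih =>
    rw [renewalTime_succ, ENNReal.ofReal_add (hnn n) (h.hazard.wait_nonneg _ _), ← ih,
      ← h.waitingTime_eq hadm le_rfl, h.path.apply_zero, Model.detectionTime]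

lemma belief_of_lt {a t : ℝ} (ha : 0 ≤ a) (ht : 0 ≤ t) {ω : Sample}
    (hlt : t < renewalTime H 0 a ω) : M.belief x y (φ a) t ω = φ (a + t) := by
  have hd : ¬ M.detectionTime x y (φ a) ω 0 ≤ ENNReal.ofReal t := by
    rw [h.detectionTime_eq hadm ha, ENNReal.ofReal_le_ofReal_iff ht]
    exact not_le.2 hlt
  rw [Model.belief, if_neg hd, h.beliefPath_eq hadm ha ht]

omit hadm in
lemma renewalTime_strictMono (a : ℝ) {ω : Sample} (hω : ∀ n, 0 < ω n) :
    StrictMono fun n => renewalTime H n a ω :=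
  strictMono_nat_of_lt_succ fun n => by
    rw [renewalTime_succ]
    linarith [h.hazard.wait_pos (a := 0) (hω (n + 1))]

lemma belief_of_le_of_lt {a t : ℝ} (ha : 0 ≤ a) (ht : 0 ≤ t) {ω : Sample} (hω : ∀ n, 0 < ω n)
    {n : ℕ} (hle : renewalTime H n a ω ≤ t) (hlt : t < renewalTime H (n + 1) a ω) :
    M.belief x y (φ a) t ω = φ (t - renewalTime H n a ω) := by
  have hmono := h.renewalTime_strictMono a hω
  have hnn : 0 ≤ renewalTime H n a ω := Finset.sum_nonneg fun i _ => h.hazard.wait_nonneg _ _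
  have hlast : M.lastDetection x y (φ a) ω t = renewalTime H n a ω := by
    rw [Model.lastDetection]
    simp only [h.detectionTime_eq hadm ha, ENNReal.ofReal_le_ofReal_iff ht]
    have : (⨆ k : ℕ, if renewalTime H k a ω ≤ t then ENNReal.ofReal (renewalTime H k a ω) else 0) =
        ENNReal.ofReal (renewalTime H n a ω) := by
      refine le_antisymm (iSup_le fun k => ?_) ?_
      · split_ifs with hk
        · have hkn : k < n + 1 := hmono.lt_iff_lt.1 (hk.trans_lt hlt)
          exact ENNReal.ofReal_le_ofReal (hmono.monotone (Nat.lt_succ_iff.1 hkn))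
        · exact zero_le
      · refine le_iSup_of_le n ?_
        rw [if_pos hle]
    rw [this, ENNReal.toReal_ofReal hnn]
  have hd : M.detectionTime x y (φ a) ω 0 ≤ ENNReal.ofReal t := by
    rw [h.detectionTime_eq hadm ha, ENNReal.ofReal_le_ofReal_iff ht]
    exact (hmono.monotone (Nat.zero_le n)).trans hle
  rw [Model.belief, if_pos hd, hlast, ← h.path.apply_zero, h.beliefPath_eq hadm le_rfl (sub_nonneg.2 hle), zero_add]

/-- The inter-renewal intervals are disjoint and one of them contains `t`, so exactly one summand of
the age function is active. -/
lemma indicator_belief_eq {a t : ℝ} (ha : 0 ≤ a) (ht : 0 ≤ t) (B : Set ℝ) {ω : Sample}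
    (hω : ∀ n, 0 < ω n) (hex : ∃ n, t < renewalTime H n a ω) :
    B.indicator (1 : ℝ → ℝ≥0∞) (M.belief x y (φ a) t ω) =
      ageFunction H (fun s => B.indicator 1 (φ s)) t a ω := by
  classical
  have hmono := h.renewalTime_strictMono a hω
  rw [ageFunction]
  by_cases h0 : t < renewalTime H 0 a ω
  · rw [if_pos h0, h.belief_of_lt hadm ha ht h0]
    have : ∀ n, ¬ (renewalTime H n a ω ≤ t ∧ t < renewalTime H (n + 1) a ω) := fun n hn =>
      absurd (h0.trans_le (hmono.monotone (Nat.zero_le n))) (not_lt.2 hn.1)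
    simp [this]
  · obtain ⟨n, hn, hmin⟩ : ∃ n, t < renewalTime H (n + 1) a ω ∧ renewalTime H n a ω ≤ t := by
      have hspec := Nat.find_spec hex
      have hne : Nat.find hex ≠ 0 := fun heq => h0 (heq ▸ hspec)
      obtain ⟨k, hk⟩ := Nat.exists_eq_succ_of_ne_zero hne
      rw [hk] at hspec
      exact ⟨k, hspec, not_lt.1 (Nat.find_min hex (by omega))⟩
    rw [if_neg h0, zero_add, h.belief_of_le_of_lt hadm ha ht hω hmin hn,
      tsum_eq_single n fun k hk => if_neg ?_, if_pos ⟨hmin, hn⟩]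
    rintro ⟨h1, h2⟩
    have h3 : k < n + 1 := hmono.lt_iff_lt.1 (h1.trans_lt hn)
    have h4 : n < k + 1 := hmono.lt_iff_lt.1 (hmin.trans_lt h2)
    omega

lemma sampleMeasure_belief_mem {a t : ℝ} (ha : 0 ≤ a) (ht : 0 ≤ t) {B : Set ℝ}
    (hB : MeasurableSet B) (hφ : Measurable φ) :
    sampleMeasure {ω | M.belief x y (φ a) t ω ∈ B} =
      ∫⁻ ω, ageFunction H (fun s => B.indicator 1 (φ s)) t a ω ∂sampleMeasure := by
  have hf : Measurable fun s => B.indicator (1 : ℝ → ℝ≥0∞) (φ s) :=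
    (measurable_one.indicator hB).comp hφ
  have hm := h.hazard.measurable_ageFunction_left hf t a
  have hae : ∀ᵐ ω ∂sampleMeasure, B.indicator (1 : ℝ → ℝ≥0∞) (M.belief x y (φ a) t ω) =
      ageFunction H (fun s => B.indicator 1 (φ s)) t a ω := by
    filter_upwards [ae_sample_pos, h.hazard.ae_exists_lt_renewalTime a t] with ω hω hex
    exact h.indicator_belief_eq hadm ha ht B hω hex
  -- The event is replaced by an almost surely equal one whose measurability follows from that of
  -- `ageFunction`.
  have hset : {ω | M.belief x y (φ a) t ω ∈ B} =ᵐ[sampleMeasure]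
      {ω | ageFunction H (fun s => B.indicator 1 (φ s)) t a ω = 1} := by
    rw [Filter.eventuallyEq_set]
    filter_upwards [hae] with ω hω
    rw [← hω]
    by_cases hb : M.belief x y (φ a) t ω ∈ B <;> simp [hb]
  rw [measure_congr hset, ← lintegral_indicator_one (measurableSet_eq_fun hm measurable_const)]
  refine lintegral_congr_ae ?_
  filter_upwards [hae] with ω hω
  by_cases hb : M.belief x y (φ a) t ω ∈ B
  · have : ageFunction H (fun s => B.indicator 1 (φ s)) t a ω = 1 := by simp [← hω, hb]
    rw [this, indicator_of_mem (by exact this), Pi.one_apply]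
  · have : ageFunction H (fun s => B.indicator 1 (φ s)) t a ω = 0 := by simp [← hω, hb]
    rw [this, indicator_of_notMem (by exact fun h1 => zero_ne_one (this.symm.trans h1))]

end IsRegeneration

/-- The normalized equilibrium age distribution. -/
noncomputable def ageLaw (H : ℝ → ℝ) : Measure ℝ :=
  (∫⁻ a in Ici 0, survival H a)⁻¹ • (volume.restrict (Ici 0)).withDensity (survival H)

namespace IsHazard

variable {H : ℝ → ℝ} {c₁ c₂ : ℝ} (h : IsHazard H c₁ c₂)

include h

lemma lintegral_survival_ne_zero : ∫⁻ a in Ici 0, survival H a ≠ 0 := by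
  rw [← pos_iff_ne_zero, setLIntegral_pos_iff h.measurable_survival]
  have : Function.support (survival H) = univ :=
    eq_univ_of_forall fun a => by simp [survival, Real.exp_pos]
  simp [this]

lemma isProbabilityMeasure_ageLaw : IsProbabilityMeasure (ageLaw H) := ⟨by
  rw [ageLaw, Measure.smul_apply, withDensity_apply _ MeasurableSet.univ, Measure.restrict_univ,
    smul_eq_mul, ENNReal.inv_mul_cancel h.lintegral_survival_ne_zero
      h.lintegral_survival_lt_top.ne]⟩

lemma lintegral_ageLaw {f : ℝ → ℝ≥0∞} (hf : Measurable f) :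
    ∫⁻ a, f a ∂ageLaw H = (∫⁻ a in Ici 0, survival H a)⁻¹ * ∫⁻ a in Ici 0, survival H a * f a := by
  rw [ageLaw, lintegral_smul_measure, smul_eq_mul,
    lintegral_withDensity_eq_lintegral_mul _ h.measurable_survival hf]
  rfl

omit h in
lemma ae_ageLaw_nonneg (H : ℝ → ℝ) : ∀ᵐ a ∂ageLaw H, 0 ≤ a := by
  refine Measure.ae_smul_measure ?_ _
  refine (withDensity_absolutelyContinuous _ _).ae_le ?_
  exact ae_restrict_mem measurableSet_Ici

end IsHazard

/-- A continuous trajectory that starts at the maximum of its range has a measurable right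
inverse. -/
lemma exists_measurable_hitting_time {φ : ℝ → ℝ} {q b τ : ℝ} (hφ : ContinuousOn φ (Ici 0))
    (h0 : φ 0 = b) (hτ : 0 ≤ τ) (hq : φ τ = q) :
    ∃ T : ℝ → ℝ, Measurable T ∧ ∀ p ∈ Icc q b, 0 ≤ T p ∧ φ (T p) = p := by
  have hbdd : ∀ p, BddBelow {t | 0 ≤ t ∧ φ t ≤ max p q} := fun p => ⟨0, fun t ht => ht.1⟩
  have hne : ∀ p, {t | 0 ≤ t ∧ φ t ≤ max p q}.Nonempty := fun p =>
    ⟨τ, hτ, hq ▸ le_max_right _ _⟩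
  -- The `max` keeps the set nonempty for every real `p`, so that the hitting time is antitone,
  -- hence measurable, on the whole line.
  refine ⟨fun p => sInf {t | 0 ≤ t ∧ φ t ≤ max p q}, ?_, fun p hp => ?_⟩
  · refine Antitone.measurable fun p p' hpp => csInf_le_csInf (hbdd _) (hne _) fun t ht =>
      ⟨ht.1, ht.2.trans (max_le_max_right q hpp)⟩
  · have hcl : IsClosed {t | 0 ≤ t ∧ φ t ≤ max p q} :=
      hφ.preimage_isClosed_of_isClosed isClosed_Ici isClosed_Iic
    obtain ⟨h1, h2⟩ := hcl.csInf_mem (hne p) (hbdd p)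
    refine ⟨h1, le_antisymm (h2.trans_eq (max_eq_left hp.1)) ?_⟩
    by_contra! hlt
    set T := sInf {t | 0 ≤ t ∧ φ t ≤ max p q} with hT
    have hTpos : 0 < T := h1.lt_of_ne fun heq => by
      rw [← heq, h0] at hlt
      exact absurd hp.2 (not_le.2 hlt)
    obtain ⟨s, hs, hsp⟩ := intermediate_value_Icc' h1 (hφ.mono Icc_subset_Ici_self)
      ⟨hlt.le, h0 ▸ hp.2⟩
    have hle : T ≤ s := csInf_le (hbdd p) ⟨hs.1, hsp ▸ le_max_left _ _⟩
    have : s = T := le_antisymm hs.2 hle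
    rw [this] at hsp
    exact absurd hsp hlt.ne

/-- The law of the belief at the age of a renewal process in equilibrium is stationary. -/
theorem IsRegeneration.isStationary {φ η H : ℝ → ℝ} {c₁ c₂ : ℝ}
    (h : IsRegeneration M x y φ η H c₁ c₂) (hadm : M.Admissible x y) (hφ : Measurable φ) {q τ : ℝ}
    (hτ : 0 ≤ τ) (hq : φ τ = q) (hge : ∀ t, 0 ≤ t → q ≤ φ t) :
    M.IsStationary x y ((ageLaw H).map φ) := by
  have hprob := h.hazard.isProbabilityMeasure_ageLaw
  have hnn := IsHazard.ae_ageLaw_nonneg H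
  refine ⟨Measure.isProbabilityMeasure_map hφ.aemeasurable, ?_, fun t ht B hB => ?_⟩
  · have : ∀ᵐ p ∂(ageLaw H).map φ, p ∈ Icc (0 : ℝ) 1 := by
      refine (ae_map_iff hφ.aemeasurable measurableSet_Icc).2 ?_
      filter_upwards [hnn] with a ha using h.path.mem ha
    exact this
  -- To change variables, the transition probability must be a measurable function of the belief. It
  -- is measurable in the age, and `T` selects an age for each belief; any age with the same belief
  -- would do.
  obtain ⟨T, hTm, hT⟩ := exists_measurable_hitting_time h.path.1 h.path.apply_zero hτ hq
  have hf : Measurable fun s => B.indicator (1 : ℝ → ℝ≥0∞) (φ s) :=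
    (measurable_one.indicator hB).comp hφ
  set k : ℝ → ℝ≥0∞ := fun a =>
    ∫⁻ ω, ageFunction H (fun s => B.indicator 1 (φ s)) t a ω ∂sampleMeasure with hk
  have hkm : Measurable k := (h.hazard.measurable_ageFunction hf t).lintegral_prod_right'
  have hkφ : ∀ a, 0 ≤ a → sampleMeasure {ω | M.belief x y (φ a) t ω ∈ B} = k a := fun a ha =>
    h.sampleMeasure_belief_mem hadm ha ht hB hφ
  have hrange : ∀ a, 0 ≤ a → φ a ∈ Icc q 1 := fun a ha => ⟨hge a ha, (h.path.mem ha).2⟩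
  have h1 : ∀ᵐ p ∂(ageLaw H).map φ,
      sampleMeasure {ω | M.belief x y p t ω ∈ B} = k (T p) := by
    have : ∀ᵐ p ∂(ageLaw H).map φ, p ∈ Icc q 1 := by
      refine (ae_map_iff hφ.aemeasurable measurableSet_Icc).2 ?_
      filter_upwards [hnn] with a ha using hrange a ha
    filter_upwards [this] with p hp
    rw [← hkφ _ (hT p hp).1, (hT p hp).2]
  have h2 : ∀ᵐ a ∂ageLaw H, k (T (φ a)) = k a := by
    filter_upwards [hnn] with a ha
    obtain ⟨h3, h4⟩ := hT _ (hrange a ha)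
    rw [← hkφ _ h3, ← hkφ _ ha, h4]
  have hkT : Measurable fun p => k (T p) := hkm.comp hTm
  rw [lintegral_congr_ae h1, lintegral_map hkT hφ, lintegral_congr_ae h2,
    h.hazard.lintegral_ageLaw hkm, hk,
    h.hazard.lintegral_age hf (fun a => indicator_le_self' (fun _ _ => zero_le) _) ht,
    ← h.hazard.lintegral_ageLaw hf, ← lintegral_map (measurable_one.indicator hB) hφ,
    lintegral_indicator_one hB]

/-! ### Construction of trajectories -/

lemma integral_drift_of_hasDerivAt {u : ℝ → ℝ} {y₀ t : ℝ} (ht : 0 ≤ t) (hc : Continuous u)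
    (hy : ∀ s ∈ Ioo 0 t, y (u s) = y₀)
    (hd : ∀ s ∈ Ioo 0 t, HasDerivAt u (M.drift x (u s) y₀) s) :
    IntervalIntegrable (fun s => M.drift x (u s) (y (u s))) volume 0 t ∧
      ∫ s in (0 : ℝ)..t, M.drift x (u s) (y (u s)) = u t - u 0 := by
  have hcont : Continuous fun s => M.drift x (u s) y₀ := by
    unfold Model.drift
    fun_prop
  have heq : EqOn (fun s => M.drift x (u s) y₀) (fun s => M.drift x (u s) (y (u s))) (Ioo 0 t) :=
    fun s hs => by simp only [hy s hs]
  constructor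
  · rw [intervalIntegrable_iff_integrableOn_Ioo_of_le ht]
    refine IntegrableOn.congr_fun ?_ heq measurableSet_Ioo
    exact (intervalIntegrable_iff_integrableOn_Ioo_of_le ht).1 (hcont.intervalIntegrable 0 t)
  · rw [intervalIntegral.integral_of_le ht, integral_Ioc_eq_integral_Ioo,
      ← setIntegral_congr_fun measurableSet_Ioo heq, ← integral_Ioc_eq_integral_Ioo,
      ← intervalIntegral.integral_of_le ht]
    exact intervalIntegral.integral_eq_sub_of_hasDerivAt_of_le ht hc.continuousOn hd
      (hcont.intervalIntegrable 0 t)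

lemma isBeliefPath_of_hasDerivAt {u : ℝ → ℝ} {y₀ : ℝ} (hc : Continuous u)
    (hmem : ∀ t, 0 ≤ t → u t ∈ Icc (0 : ℝ) 1) (hy : ∀ s, 0 < s → y (u s) = y₀)
    (hd : ∀ s, 0 < s → HasDerivAt u (M.drift x (u s) y₀) s) : M.IsBeliefPath x y (u 0) u := by
  refine ⟨hc.continuousOn, fun t ht => ?_⟩
  obtain ⟨h1, h2⟩ := integral_drift_of_hasDerivAt (M := M) (x := x) (y := y) ht hc
    (fun s hs => hy s hs.1) fun s hs => hd s hs.1
  exact ⟨hmem t ht, h1, by rw [h2]; ring⟩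

/-- A trajectory may be prepended to another one. -/
lemma Model.IsBeliefPath.concat {q τ : ℝ} {φ : ℝ → ℝ} (h : M.IsBeliefPath x y q φ) {u : ℝ → ℝ}
    {y₀ : ℝ} (hτ : 0 ≤ τ) (hc : Continuous u) (huτ : u τ = q)
    (hmem : ∀ t ∈ Icc 0 τ, u t ∈ Icc (0 : ℝ) 1) (hy : ∀ s ∈ Ioo 0 τ, y (u s) = y₀)
    (hd : ∀ s ∈ Ioo 0 τ, HasDerivAt u (M.drift x (u s) y₀) s) :
    M.IsBeliefPath x y (u 0) fun t => u (min t τ) + (φ (max (t - τ) 0) - q) := by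
  -- Clamping both times makes one summand frozen on each side of `τ`, so continuity needs no
  -- gluing.
  set ψ : ℝ → ℝ := fun t => u (min t τ) + (φ (max (t - τ) 0) - q) with hψ
  have hle : ∀ t, t ≤ τ → ψ t = u t := fun t ht => by
    simp only [hψ]
    rw [min_eq_left ht, max_eq_right (sub_nonpos.2 ht), h.apply_zero, sub_self, add_zero]
  have hge : ∀ t, τ ≤ t → ψ t = φ (t - τ) := fun t ht => by
    simp only [hψ]
    rw [min_eq_right ht, max_eq_left (sub_nonneg.2 ht), huτ, add_sub_cancel]
  set F : ℝ → ℝ := fun s => M.drift x (ψ s) (y (ψ s)) with hF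
  have before : ∀ t, 0 ≤ t → t ≤ τ → IntervalIntegrable F volume 0 t ∧
      ∫ s in (0 : ℝ)..t, F s = u t - u 0 := by
    intro t ht htτ
    have hsub : Ioo 0 t ⊆ Ioo 0 τ := Ioo_subset_Ioo_right htτ
    have h1 := integral_drift_of_hasDerivAt (M := M) (x := x) (y := y) ht hc
      (fun s hs => hy s (hsub hs)) fun s hs => hd s (hsub hs)
    have heq : ∀ s ∈ uIcc 0 t, M.drift x (u s) (y (u s)) = F s := fun s hs => by
      rw [uIcc_of_le ht] at hs
      simp only [hF, hle s (hs.2.trans htτ)]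
    refine ⟨h1.1.congr fun s hs => heq s (uIoc_subset_uIcc hs), ?_⟩
    rw [← intervalIntegral.integral_congr heq, h1.2]
  have after : ∀ t, τ ≤ t → IntervalIntegrable F volume τ t ∧
      ∫ s in τ..t, F s = φ (t - τ) - q := by
    intro t ht
    have h0 := sub_nonneg.2 ht
    have h1 := (h.intervalIntegrable le_rfl h0).comp_sub_right τ
    rw [zero_add, sub_add_cancel] at h1
    have heq : ∀ s ∈ uIcc τ t, M.drift x (φ (s - τ)) (y (φ (s - τ))) = F s := fun s hs => by
      rw [uIcc_of_le ht] at hs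
      simp only [hF, hge s hs.1]
    refine ⟨h1.congr fun s hs => heq s (uIoc_subset_uIcc hs), ?_⟩
    rw [← intervalIntegral.integral_congr heq]
    have h2 := intervalIntegral.integral_comp_sub_right (a := τ) (b := t)
      (fun s => M.drift x (φ s) (y (φ s))) τ
    rw [h2, sub_self, ← h.sub_eq le_rfl h0, h.apply_zero]
  refine ⟨?_, fun t ht => ?_⟩
  · refine ContinuousOn.add (by fun_prop) (ContinuousOn.sub ?_ continuousOn_const)
    exact h.1.comp (by fun_prop) fun t _ => mem_Ici.2 (le_max_right _ _)
  · rcases le_total t τ with htτ | htτ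
    · obtain ⟨h1, h2⟩ := before t ht htτ
      refine ⟨?_, h1, ?_⟩
      · rw [hle t htτ]
        exact hmem t ⟨ht, htτ⟩
      · rw [hle t htτ]
        exact (by rw [h2]; ring : u t = u 0 + ∫ s in (0 : ℝ)..t, F s)
    · obtain ⟨h1, h2⟩ := before τ hτ le_rfl
      obtain ⟨h3, h4⟩ := after t htτ
      refine ⟨?_, h1.trans h3, ?_⟩
      · rw [hge t htτ]
        exact h.mem (sub_nonneg.2 htτ)
      · have h5 : ∫ s in (0 : ℝ)..t, F s = φ (t - τ) - u 0 := by
          rw [← intervalIntegral.integral_add_adjacent_intervals h1 h3, h2, h4, huτ]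
          ring
        rw [hge t htτ]
        exact (by rw [h5]; ring : φ (t - τ) = u 0 + ∫ s in (0 : ℝ)..t, F s)

/-! ### Trajectories without enforcement -/

/-- The trajectory of the belief from `p` without enforcement. -/
noncomputable def Model.relax (M : Model) (p t : ℝ) : ℝ :=
  M.pi0 + (p - M.pi0) * Real.exp (-(M.rhoH + M.rhoL) * t)

lemma Model.relax_zero (M : Model) (p : ℝ) : M.relax p 0 = p := by simp [Model.relax]

lemma Model.continuous_relax (M : Model) (p : ℝ) : Continuous (M.relax p) := by
  unfold Model.relax
  fun_prop

lemma Model.hasDerivAt_relax (M : Model) (x p t : ℝ) :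
    HasDerivAt (M.relax p) (M.drift x (M.relax p t) 0) t := by
  have h1 : HasDerivAt (fun t : ℝ => -(M.rhoH + M.rhoL) * t) (-(M.rhoH + M.rhoL)) t := by
    simpa using (hasDerivAt_id t).const_mul (-(M.rhoH + M.rhoL))
  refine HasDerivAt.congr_deriv ((h1.exp.const_mul (p - M.pi0)).const_add M.pi0) ?_
  rw [M.drift_eq, Model.relax]
  ring

lemma Model.exp_switch_mem (M : Model) {t : ℝ} (ht : 0 ≤ t) :
    Real.exp (-(M.rhoH + M.rhoL) * t) ∈ Ioc (0 : ℝ) 1 :=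
  ⟨Real.exp_pos _, by
    rw [Real.exp_le_one_iff]
    nlinarith [M.switch_pos]⟩

lemma Model.relax_mem (M : Model) {p a b : ℝ} (hp : p ∈ Icc a b) (hpi : M.pi0 ∈ Icc a b) {t : ℝ}
    (ht : 0 ≤ t) : M.relax p t ∈ Icc a b := by
  obtain ⟨h0, h1⟩ := M.exp_switch_mem ht
  have h2 : M.relax p t = (1 - Real.exp (-(M.rhoH + M.rhoL) * t)) * M.pi0 +
      Real.exp (-(M.rhoH + M.rhoL) * t) * p := by
    rw [Model.relax]
    ring
  rw [h2]
  exact convex_Icc a b hpi hp (by linarith) h0.le (by ring)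

/-- Below `pi0`, the belief without enforcement reaches every higher belief below `pi0`. -/
lemma Model.exists_relax_eq (M : Model) {p q : ℝ} (hpq : p < q) (hq : q < M.pi0) :
    ∃ τ, 0 ≤ τ ∧ M.relax p τ = q ∧ ∀ t, t < τ → M.relax p t < q := by
  have hR := M.switch_pos
  have h1 : 0 < M.pi0 - q := by linarith
  have h2 : 0 < M.pi0 - p := by linarith
  set τ := Real.log ((M.pi0 - p) / (M.pi0 - q)) / (M.rhoH + M.rhoL) with hτ
  have hexp : Real.exp (-(M.rhoH + M.rhoL) * τ) = (M.pi0 - q) / (M.pi0 - p) := by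
    rw [hτ, neg_mul, mul_div_cancel₀ _ hR.ne', ← Real.log_inv, inv_div, Real.exp_log (by positivity)]
  have hval : M.relax p τ = q := by
    rw [Model.relax, hexp]
    field_simp
    ring
  refine ⟨τ, ?_, hval, fun t ht => ?_⟩
  · refine div_nonneg (Real.log_nonneg ?_) hR.le
    rw [one_le_div h1]
    linarith
  · rw [← hval, Model.relax, Model.relax]
    have : Real.exp (-(M.rhoH + M.rhoL) * τ) < Real.exp (-(M.rhoH + M.rhoL) * t) := by
      rw [Real.exp_lt_exp]
      nlinarith
    nlinarith

/-! ### Trajectories under full enforcement -/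

/-- `r₁` and `r₂` are the roots of the drift under full enforcement when crime opportunities lead
to crimes at rate `k`. -/
def Model.IsRoots (M : Model) (k r₁ r₂ : ℝ) : Prop :=
  ∀ u, (M.rhoH + M.rhoL) * (M.pi0 - u) - u * (1 - u) * k = k * (u - r₁) * (u - r₂)

/-- Solutions of the Riccati equation `u' = k (u - r₁) (u - r₂)` between the roots. -/
lemma exists_riccati {k r₁ r₂ p q : ℝ} (hk : 0 < k) (hq : r₁ < q) (hpq : q < p) (hp : p < r₂) :
    ∃ (u : ℝ → ℝ) (τ : ℝ), 0 < τ ∧ Continuous u ∧ u 0 = p ∧ u τ = q ∧ (∀ t, t < τ → q < u t) ∧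
      (∀ t, 0 ≤ t → u t ≤ p) ∧ (∀ t, u t ≤ r₂) ∧
      (∀ t, HasDerivAt u (k * (u t - r₁) * (u t - r₂)) t) ∧
      Real.exp (-(k * ∫ s in (0 : ℝ)..τ, u s)) =
        ((q - r₁) * (r₂ - p) / ((r₂ - q) * (p - r₁))) ^ (r₁ / (r₂ - r₁)) *
          ((r₂ - p) / (r₂ - q)) := by
  set δ := k * (r₂ - r₁) with hδ
  have h12 : 0 < r₂ - r₁ := by linarith
  have hδpos : 0 < δ := mul_pos hk h12
  have hp1 : 0 < p - r₁ := by linarith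
  have hp2 : 0 < r₂ - p := by linarith
  have hq1 : 0 < q - r₁ := by linarith
  have hq2 : 0 < r₂ - q := by linarith
  set K := (p - r₁) / (r₂ - p) with hK
  set z := (q - r₁) / (r₂ - q) with hz
  have hKpos : 0 < K := by positivity
  have hzpos : 0 < z := by positivity
  -- The Möbius coordinate `w = (u - r₁) / (r₂ - u)` linearizes the equation to `w' = -δ w`; `m`
  -- below is its inverse.
  set w : ℝ → ℝ := fun t => K * Real.exp (-δ * t) with hw
  have hwpos : ∀ t, 0 < w t := fun t => by positivity
  set m : ℝ → ℝ := fun w => (r₁ + r₂ * w) / (1 + w) with hm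
  have hmono : ∀ a b, 0 < a → a ≤ b → m a ≤ m b := fun a b ha hab => by
    simp only [hm]
    rw [div_le_div_iff₀ (by linarith) (by linarith)]
    nlinarith
  have hmono' : ∀ a b, 0 < a → a < b → m a < m b := fun a b ha hab => by
    simp only [hm]
    rw [div_lt_div_iff₀ (by linarith) (by linarith)]
    nlinarith
  have hmK : m K = p := by
    simp only [hm, hK]
    field_simp
    ring
  have hmz : m z = q := by
    simp only [hm, hz]
    field_simp
    ring
  set τ := Real.log (K / z) / δ with hτ
  have hzK : z < K := by
    rw [hz, hK, div_lt_div_iff₀ hq2 hp2]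
    nlinarith
  have hwτ : w τ = z := by
    simp only [hw, hτ]
    rw [neg_mul, mul_div_cancel₀ _ hδpos.ne', ← Real.log_inv, inv_div, Real.exp_log (by positivity)]
    field_simp
  have hw0 : w 0 = K := by simp [hw]
  have hwd : ∀ t, HasDerivAt w (-δ * w t) t := fun t => by
    have h1 : HasDerivAt (fun t : ℝ => -δ * t) (-δ) t := by
      simpa using (hasDerivAt_id t).const_mul (-δ)
    refine HasDerivAt.congr_deriv (h1.exp.const_mul K) ?_
    simp only [hw]
    ring
  have hud : ∀ t, HasDerivAt (fun t => m (w t)) (k * (m (w t) - r₁) * (m (w t) - r₂)) t := by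
    intro t
    have h1 : 1 + w t ≠ 0 := by linarith [hwpos t]
    refine HasDerivAt.congr_deriv ((((hwd t).const_mul r₂).const_add r₁).div ((hwd t).const_add 1) h1) ?_
    simp only [hm, hδ]
    field_simp
    ring
  have hcont : Continuous fun t => m (w t) :=
    continuous_iff_continuousAt.2 fun t => (hud t).continuousAt
  refine ⟨fun t => m (w t), τ, ?_, hcont, by simp only [hw0, hmK], by simp only [hwτ, hmz],
    fun t ht => ?_, fun t ht => ?_, fun t => ?_, hud, ?_⟩
  · exact div_pos (Real.log_pos ((one_lt_div hzpos).2 hzK)) hδpos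
  · rw [← hmz, ← hwτ]
    refine hmono' _ _ (hwpos _) ?_
    simp only [hw]
    refine mul_lt_mul_of_pos_left (Real.exp_lt_exp.2 ?_) hKpos
    nlinarith
  · rw [← hmK]
    refine hmono _ _ (hwpos _) ?_
    refine mul_le_of_le_one_right hKpos.le (Real.exp_le_one_iff.2 ?_)
    nlinarith
  · simp only [hm]
    rw [div_le_iff₀ (by linarith [hwpos t])]
    linarith
  -- Since `k m(w) = k r₁ + δ w / (1 + w)` and `w' = -δ w`, the second term integrates to a
  -- logarithm.
  · have hG : ∀ t, HasDerivAt (fun t => k * r₁ * t - Real.log (1 + w t)) (k * m (w t)) t := by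
      intro t
      have h1 : 1 + w t ≠ 0 := by linarith [hwpos t]
      have h2 : HasDerivAt (fun t : ℝ => k * r₁ * t) (k * r₁) t := by
        simpa using (hasDerivAt_id t).const_mul (k * r₁)
      refine HasDerivAt.congr_deriv (h2.sub (((hwd t).const_add 1).log h1)) ?_
      simp only [hm, hδ]
      field_simp
      ring
    have hint := intervalIntegral.integral_eq_sub_of_hasDerivAt (a := 0) (b := τ)
      (fun t _ => hG t) ((continuous_const.mul hcont).intervalIntegrable _ _)
    rw [← intervalIntegral.integral_const_mul, hint, hwτ, hw0]
    have e1 : (q - r₁) * (r₂ - p) / ((r₂ - q) * (p - r₁)) = z / K := by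
      simp only [hz, hK]
      field_simp
    have e2 : (r₂ - p) / (r₂ - q) = (1 + z) / (1 + K) := by
      simp only [hz, hK]
      field_simp
      ring
    have e3 : -(k * r₁ * τ - Real.log (1 + z) - (k * r₁ * 0 - Real.log (1 + K))) =
        Real.log (z / K) * (r₁ / (r₂ - r₁)) + (Real.log (1 + z) - Real.log (1 + K)) := by
      rw [hτ, hδ, ← inv_div z K, Real.log_inv]
      field_simp
      ring
    rw [e1, e2, e3, Real.exp_add, Real.exp_sub, Real.exp_log (by positivity),
      Real.exp_log (by positivity), Real.rpow_def_of_pos (by positivity)]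

/-! ### Cutoff policies -/

/-- Full enforcement above `q`, none below, and enforcement `Y` at `q`. -/
noncomputable def cutoffPolicy (q Y p : ℝ) : ℝ := if p < q then 0 else if q < p then 1 else Y

lemma cutoffPolicy_of_lt {q Y p : ℝ} (h : p < q) : cutoffPolicy q Y p = 0 := if_pos h

lemma cutoffPolicy_of_gt {q Y p : ℝ} (h : q < p) : cutoffPolicy q Y p = 1 := by
  rw [cutoffPolicy, if_neg (not_lt.2 h.le), if_pos h]

lemma cutoffPolicy_self (q Y : ℝ) : cutoffPolicy q Y q = Y := by simp [cutoffPolicy]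

lemma cutoffPolicy_mem {q Y : ℝ} (hY : Y ∈ Icc (0 : ℝ) 1) (p : ℝ) :
    cutoffPolicy q Y p ∈ Icc (0 : ℝ) 1 := by
  rw [cutoffPolicy]
  split_ifs
  exacts [⟨le_rfl, zero_le_one⟩, ⟨zero_le_one, le_rfl⟩, hY]

lemma monotone_cutoffPolicy {q Y : ℝ} (hY : Y ∈ Icc (0 : ℝ) 1) : Monotone (cutoffPolicy q Y) := by
  intro a b hab
  rcases lt_trichotomy a q with ha | ha | ha
  · rw [cutoffPolicy_of_lt ha]
    exact (cutoffPolicy_mem hY b).1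
  · rcases hab.eq_or_lt with heq | hlt
    · rw [heq]
    · rw [cutoffPolicy_of_gt (ha ▸ hlt : q < b)]
      exact (cutoffPolicy_mem hY a).2
  · rw [cutoffPolicy_of_gt ha, cutoffPolicy_of_gt (ha.trans_le hab)]

/-- At `q` the policymaker is indifferent, so `Y` remains free to be fixed by admissibility. -/
lemma isMyopicOptimum_cutoffPolicy {q Y : ℝ} (hx : 0 < x) (hxq : M.lam * x * q = M.c)
    (hY : Y ∈ Icc (0 : ℝ) 1) (p : ℝ) : M.IsMyopicOptimum x p (cutoffPolicy q Y p) := by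
  have hk := mul_pos M.lam_pos hx
  refine Model.isMyopicOptimum_of_eq (cutoffPolicy_mem hY p) (fun h => ?_) fun h => ?_
  · exact cutoffPolicy_of_lt (lt_of_mul_lt_mul_left (h.trans_eq hxq.symm) hk.le)
  · exact cutoffPolicy_of_gt (lt_of_mul_lt_mul_left (hxq.trans_lt h) hk.le)

/-! ### The roots of the drift under full enforcement -/

/-- With `R = rhoH + rhoL`, the drift under full enforcement is `k u² - (k + R) u + rhoL`. Its
discriminant equals `(k - R)² + 4 k rhoH`, so the roots are real. -/
noncomputable def Model.rootDisc (M : Model) (k : ℝ) : ℝ :=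
  Real.sqrt ((k + (M.rhoH + M.rhoL)) ^ 2 - 4 * k * M.rhoL)

noncomputable def Model.loRoot (M : Model) (k : ℝ) : ℝ :=
  (k + (M.rhoH + M.rhoL) - M.rootDisc k) / (2 * k)

noncomputable def Model.hiRoot (M : Model) (k : ℝ) : ℝ :=
  (k + (M.rhoH + M.rhoL) + M.rootDisc k) / (2 * k)

lemma Model.isRoots (M : Model) {k : ℝ} (hk : 0 < k) : M.IsRoots k (M.loRoot k) (M.hiRoot k) := by
  intro u
  have hD : M.rootDisc k ^ 2 = (k + (M.rhoH + M.rhoL)) ^ 2 - 4 * k * M.rhoL := by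
    refine Real.sq_sqrt ?_
    nlinarith [sq_nonneg (k - (M.rhoH + M.rhoL)), mul_pos hk M.rhoH_pos]
  rw [mul_sub, M.switch_mul_pi0, Model.loRoot, Model.hiRoot]
  field_simp
  linear_combination hD

lemma Model.loRoot_le_hiRoot (M : Model) {k : ℝ} (hk : 0 < k) : M.loRoot k ≤ M.hiRoot k := by
  have : 0 ≤ M.rootDisc k := Real.sqrt_nonneg _
  rw [Model.loRoot, Model.hiRoot]
  gcongr
  linarith

lemma Model.mem_Ioo_roots (M : Model) {k u : ℝ} (hk : 0 < k)
    (hu : (M.rhoH + M.rhoL) * (M.pi0 - u) - u * (1 - u) * k < 0) :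
    M.loRoot k < u ∧ u < M.hiRoot k := by
  rw [M.isRoots hk u, mul_assoc] at hu
  have h1 := M.loRoot_le_hiRoot hk
  have h2 : (u - M.loRoot k) * (u - M.hiRoot k) < 0 := by
    by_contra! hcon
    exact absurd hu (not_lt.2 (mul_nonneg hk.le hcon))
  rcases mul_neg_iff.1 h2 with h3 | h3
  · exact ⟨by linarith, by linarith⟩
  · linarith

lemma Model.one_mem_Ioo_roots (M : Model) {k : ℝ} (hk : 0 < k) :
    M.loRoot k < 1 ∧ 1 < M.hiRoot k :=
  M.mem_Ioo_roots hk (by nlinarith [mul_pos M.switch_pos (sub_pos.2 M.pi0_lt_one)])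

lemma Model.loRoot_pos (M : Model) {k : ℝ} (hk : 0 < k) : 0 < M.loRoot k := by
  have h1 := M.isRoots hk 0
  have h2 := M.one_mem_Ioo_roots hk
  have h3 := mul_pos M.switch_pos M.pi0_pos
  by_contra! hcon
  nlinarith [mul_nonneg (mul_nonneg hk.le (neg_nonneg.2 hcon)) (by linarith : 0 ≤ M.hiRoot k)]

/-! ### Admissibility of cutoff policies -/

lemma drift_one_eq (x u : ℝ) {k : ℝ} (hk : k = M.lam * x) (hk0 : 0 < k) :
    k * (u - M.loRoot k) * (u - M.hiRoot k) = M.drift x u 1 := by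
  rw [← M.isRoots hk0 u, M.drift_eq, hk]
  ring

/-- Negative drift at `q` and at one places `[q, 1]` strictly between the roots, so the descent
reaches `q` in finite time and `φ` can take over. -/
lemma exists_isBeliefPath_above {q Y p : ℝ} (hx : 0 < x) (hq0 : 0 ≤ q)
    (hq : M.drift x q 1 < 0) {φ : ℝ → ℝ} (hφ : M.IsBeliefPath x (cutoffPolicy q Y) q φ)
    (hqp : q < p) (hp : p ≤ 1) : ∃ ψ, M.IsBeliefPath x (cutoffPolicy q Y) p ψ := by
  have hk := mul_pos M.lam_pos hx
  rw [M.drift_eq, mul_one] at hq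
  obtain ⟨u, τ, hτ, hc, h0, h1, hgt, hle, -, hd, -⟩ := exists_riccati hk
    (M.mem_Ioo_roots hk hq).1 hqp (hp.trans_lt (M.one_mem_Ioo_roots hk).2)
  rw [← h0]
  refine ⟨_, hφ.concat (y₀ := 1) hτ.le hc h1 (fun t ht => ⟨?_, (hle t ht.1).trans hp⟩)
    (fun s hs => cutoffPolicy_of_gt (hgt s hs.2)) fun s hs =>
    (hd s).congr_deriv (drift_one_eq x _ rfl hk)⟩
  rcases ht.2.eq_or_lt with heq | hlt
  · rw [heq, h1]
    exact hq0
  · exact hq0.trans (hgt t hlt).le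

/-- An unenforced belief moves between its start and `π₀`, both at most `q`; with no enforcement at
`q` itself, it stays in the unenforced region. -/
lemma admissible_cutoffPolicy_of_pi0_le {q : ℝ} (hx : x ∈ Ioc (0 : ℝ) 1) (hq : M.pi0 ≤ q) :
    M.Admissible x (cutoffPolicy q 0) := by
  have hY : (0 : ℝ) ∈ Icc (0 : ℝ) 1 := ⟨le_rfl, zero_le_one⟩
  have hle : ∀ p ≤ q, cutoffPolicy q 0 p = 0 := fun p hp => by
    rcases hp.eq_or_lt with heq | hlt
    · rw [heq, cutoffPolicy_self]
    · exact cutoffPolicy_of_lt hlt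
  have hbelow : ∀ p, p ∈ Icc (0 : ℝ) 1 → p ≤ q →
      ∃ φ, M.IsBeliefPath x (cutoffPolicy q 0) p φ := by
    intro p hp hpq
    refine ⟨M.relax p, ?_⟩
    have := isBeliefPath_of_hasDerivAt (M := M) (x := x) (y := cutoffPolicy q 0) (y₀ := 0)
      (M.continuous_relax p) (fun t ht => M.relax_mem hp M.pi0_mem ht)
      (fun s hs => hle _ (M.relax_mem (a := min p M.pi0) ⟨min_le_left _ _, hpq⟩
        ⟨min_le_right _ _, hq⟩ hs.le).2) fun s _ => M.hasDerivAt_relax x p s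
    rwa [M.relax_zero] at this
  refine Model.admissible_of_monotoneOn ⟨hx.1.le, hx.2⟩ ((monotone_cutoffPolicy hY).monotoneOn _)
    (fun u _ => cutoffPolicy_mem hY u) fun p hp => ?_
  rcases le_or_gt p q with hpq | hpq
  · exact hbelow p hp hpq
  · have hq0 : 0 < q := M.pi0_pos.trans_le hq
    have hq1 : q < 1 := hpq.trans_le hp.2
    obtain ⟨φ, hφ⟩ := hbelow q ⟨hq0.le, hq1.le⟩ le_rfl
    refine exists_isBeliefPath_above hx.1 hq0.le ?_ hφ hpq hp.2
    rw [M.drift_eq]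
    have h1 := mul_pos M.lam_pos hx.1
    have h2 : 0 < q * (1 - q) * (M.lam * x) * 1 := by
      have := sub_pos.2 hq1
      positivity
    nlinarith [M.switch_pos]

lemma isBeliefPath_const {q : ℝ} (hq : q ∈ Icc (0 : ℝ) 1) (h0 : M.drift x q (y q) = 0) :
    M.IsBeliefPath x y q fun _ => q :=
  isBeliefPath_of_hasDerivAt (u := fun _ => q) (y₀ := y q) continuous_const (fun _ _ => hq)
    (fun _ _ => rfl) fun s _ => (hasDerivAt_const s q).congr_deriv h0.symm

/-- Here `q` attracts from both sides in finite time, so trajectories exist only because `Y` makes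
it a rest point. -/
lemma admissible_cutoffPolicy_of_lt_pi0 {q Y : ℝ} (hx : x ∈ Ioc (0 : ℝ) 1) (hq0 : 0 ≤ q)
    (hq : q < M.pi0) (hY : Y ∈ Icc (0 : ℝ) 1) (h0 : M.drift x q Y = 0)
    (h1 : M.drift x q 1 < 0) : M.Admissible x (cutoffPolicy q Y) := by
  have hq1 : q < 1 := hq.trans M.pi0_lt_one
  have hconst : M.IsBeliefPath x (cutoffPolicy q Y) q fun _ => q :=
    isBeliefPath_const ⟨hq0, hq1.le⟩ (by rw [cutoffPolicy_self, h0])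
  refine Model.admissible_of_monotoneOn ⟨hx.1.le, hx.2⟩ ((monotone_cutoffPolicy hY).monotoneOn _)
    (fun u _ => cutoffPolicy_mem hY u) fun p hp => ?_
  rcases lt_trichotomy p q with hpq | hpq | hpq
  · obtain ⟨τ, hτ, hval, hlt⟩ := M.exists_relax_eq hpq hq
    have := hconst.concat (y₀ := 0) hτ (M.continuous_relax p) hval
      (fun t ht => M.relax_mem hp M.pi0_mem ht.1) (fun s hs => cutoffPolicy_of_lt (hlt s hs.2))
      fun s _ => M.hasDerivAt_relax x p s
    rw [M.relax_zero] at this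
    exact ⟨_, this⟩
  · rw [hpq]
    exact ⟨_, hconst⟩
  · exact exists_isBeliefPath_above hx.1 hq0 h1 hconst hpq hp.2

/-! ### The long-run distribution under partial enforcement -/

lemma integral_Ioi_eq_add_of_exp {f g : ℝ → ℝ} {τ C b : ℝ} (hτ : 0 ≤ τ) (hb : 0 < b)
    (hg : Continuous g) (hfg : ∀ t ∈ Ioo 0 τ, f t = g t)
    (hf : ∀ t, τ < t → f t = C * Real.exp (-b * (t - τ))) :
    IntegrableOn f (Ioi 0) ∧ ∫ t in Ioi 0, f t = (∫ t in (0 : ℝ)..τ, g t) + C / b := by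
  have hexp : ∀ t, C * Real.exp (-b * (t - τ)) =
      C * Real.exp (b * τ) * Real.exp (-b * t) := fun t => by
    rw [mul_assoc, ← Real.exp_add]
    ring_nf
  have h1 : IntegrableOn f (Ioc 0 τ) := by
    rw [integrableOn_Ioc_iff_integrableOn_Ioo]
    refine IntegrableOn.congr_fun ?_ (fun t ht => (hfg t ht).symm) measurableSet_Ioo
    exact (hg.integrableOn_Icc (a := 0) (b := τ)).mono_set Ioo_subset_Icc_self
  have h2 : IntegrableOn f (Ioi τ) := by
    refine IntegrableOn.congr_fun ?_ (fun t ht => (hf t ht).symm) measurableSet_Ioi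
    simp only [hexp]
    exact (integrableOn_exp_mul_Ioi (neg_lt_zero.2 hb) τ).const_mul _
  rw [← Ioc_union_Ioi_eq_Ioi hτ]
  refine ⟨h1.union h2, ?_⟩
  rw [setIntegral_union (Ioc_disjoint_Ioi le_rfl) measurableSet_Ioi h1 h2]
  congr 1
  · rw [intervalIntegral.integral_of_le hτ, integral_Ioc_eq_integral_Ioo,
      integral_Ioc_eq_integral_Ioo]
    exact setIntegral_congr_fun measurableSet_Ioo hfg
  · rw [setIntegral_congr_fun measurableSet_Ioi hf]
    simp only [hexp]
    rw [integral_const_mul, integral_exp_mul_Ioi (neg_lt_zero.2 hb), mul_div_assoc', mul_neg,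
      neg_div_neg_eq, mul_assoc, ← Real.exp_add]
    simp

lemma integral_ageLaw {H : ℝ → ℝ} {c₁ c₂ : ℝ} (h : IsHazard H c₁ c₂) (f : ℝ → ℝ) :
    ∫ a, f a ∂ageLaw H = (∫ a in Ioi 0, Real.exp (-H a))⁻¹ *
      ∫ a in Ioi 0, Real.exp (-H a) * f a := by
  have hS := h.measurable_survival
  have hm := h.measurable
  have h1 : (∫⁻ a in Ici 0, survival H a).toReal = ∫ a in Ioi 0, Real.exp (-H a) := by
    rw [integral_eq_lintegral_of_nonneg_ae (Filter.Eventually.of_forall fun a =>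
      (Real.exp_pos _).le) (by fun_prop), setLIntegral_congr Ioi_ae_eq_Ici]
    rfl
  rw [ageLaw, integral_smul_measure, ENNReal.toReal_inv, h1,
    integral_withDensity_eq_integral_toReal_smul hS
      (Filter.Eventually.of_forall fun a => ENNReal.ofReal_lt_top),
    integral_Ici_eq_integral_Ioi]
  simp [survival, Real.exp_nonneg]

/-- The expected enforcement conditional on the high state is the ratio of the mean detection
rate to that under full enforcement. -/
lemma IsRegeneration.integral_conditionalOnHigh {φ η H : ℝ → ℝ} {c₁ c₂ : ℝ}
    (h : IsRegeneration M x y φ η H c₁ c₂) (hx : 0 < x) (hφ : Measurable φ) (hy : Measurable y) :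
    ∫ p, y p ∂(M.conditionalOnHigh ((ageLaw H).map φ)) =
      (∫ a in Ioi 0, Real.exp (-H a))⁻¹ * ((∫ a in Ioi 0, Real.exp (-H a) * η a) /
        (M.lam * x * M.pi0)) := by
  have hl := M.lam_pos
  have hpi := M.pi0_pos
  rw [Model.conditionalOnHigh, integral_withDensity_eq_integral_toReal_smul (by fun_prop)
    (Filter.Eventually.of_forall fun a => ENNReal.ofReal_lt_top),
    integral_map hφ.aemeasurable (by fun_prop), integral_ageLaw h.hazard, ← integral_div]
  congr 1
  refine setIntegral_congr_fun measurableSet_Ioi fun a ha => ?_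
  have ha0 : 0 ≤ a := (mem_Ioi.1 ha).le
  have hr := h.rate a ha0
  have hm := h.path.mem ha0
  rw [Model.detectionRate] at hr
  rw [ENNReal.toReal_ofReal (div_nonneg hm.1 hpi.le), ← hr, smul_eq_mul]
  field_simp

/-- The probability that, under full enforcement, the belief moves from one to `q` without a
detection, when crime opportunities lead to crimes at rate `k`. -/
noncomputable def Model.descentSurvival (M : Model) (k q : ℝ) : ℝ :=
  ((q - M.loRoot k) * (M.hiRoot k - 1) / ((M.hiRoot k - q) * (1 - M.loRoot k))) ^
    (M.loRoot k / (M.hiRoot k - M.loRoot k)) * ((M.hiRoot k - 1) / (M.hiRoot k - q))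

/-- Let `A` be the mean time before the next detection spent on the descent from one to `q`. The
mean time between detections is `A + s / (c Y)`: with probability `s` the belief reaches `q`, where
detections arrive at rate `c Y`. Expected enforcement is the reciprocal of this mean divided by `λ x
π₀`. -/
theorem exists_isStationary_cutoffPolicy {q Y : ℝ} (hx : x ∈ Ioc (0 : ℝ) 1) (hq0 : 0 < q)
    (hq : q < M.pi0) (hxq : M.lam * x * q = M.c) (hY0 : 0 < Y) (hY1 : Y < 1)
    (hYq : M.c * Y * (1 - q) = (M.rhoH + M.rhoL) * (M.pi0 - q)) :
    M.Admissible x (cutoffPolicy q Y) ∧ ∃ Φ, M.IsStationary x (cutoffPolicy q Y) Φ ∧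
      (∫ p, cutoffPolicy q Y p ∂(M.conditionalOnHigh Φ)) *
        (Y + M.descentSurvival (M.lam * x) q * (1 - Y)) = Y := by
  have hk := mul_pos M.lam_pos hx.1
  have hR := M.switch_pos
  have hpi := M.pi0_pos
  have hc := M.c_pos
  have hq1 : q < 1 := hq.trans M.pi0_lt_one
  set k := M.lam * x with hkdef
  have hY : Y ∈ Icc (0 : ℝ) 1 := ⟨hY0.le, hY1.le⟩
  have hdY : M.drift x q Y = 0 := by
    rw [M.drift_eq, ← hkdef]
    linear_combination -hYq - (1 - q) * Y * hxq
  have hd1 : M.drift x q 1 < 0 := by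
    have : M.drift x q 1 = -(M.c * (1 - q) * (1 - Y)) := by
      rw [M.drift_eq, ← hkdef]
      linear_combination -hYq - (1 - q) * hxq
    rw [this]
    exact neg_lt_zero.2 (mul_pos (mul_pos hc (by linarith)) (by linarith))
  have hadm := admissible_cutoffPolicy_of_lt_pi0 hx hq0.le hq hY hdY hd1
  refine ⟨hadm, ?_⟩
  have hd1' := hd1
  rw [M.drift_eq, mul_one] at hd1'
  obtain ⟨u, τ, hτ, huc, hu0, huτ, hgt, hle, hle2, hud, hsurv⟩ := exists_riccati hk
    (M.mem_Ioo_roots hk hd1').1 hq1 (M.one_mem_Ioo_roots hk).2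
  change Real.exp _ = M.descentSurvival k q at hsurv
  set s := M.descentSurvival k q with hs
  set φ : ℝ → ℝ := fun t => u (min t τ) with hφ
  have hφm : Measurable φ := (huc.comp (by fun_prop)).measurable
  have hpath : M.IsBeliefPath x (cutoffPolicy q Y) 1 φ := by
    have hconst : M.IsBeliefPath x (cutoffPolicy q Y) q fun _ => q :=
      isBeliefPath_const ⟨hq0.le, hq1.le⟩ (by rw [cutoffPolicy_self, hdY])
    have := hconst.concat (y₀ := 1) hτ.le huc huτ (fun t ht => ⟨?_, hle t ht.1⟩)
      (fun s hs => cutoffPolicy_of_gt (hgt s hs.2)) fun s hs =>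
      (hud s).congr_deriv (drift_one_eq x _ rfl hk)
    · rw [hu0] at this
      simpa only [sub_self, add_zero] using this
    · rcases ht.2.eq_or_lt with heq | hlt
      · rw [heq, huτ]
        exact hq0.le
      · exact hq0.le.trans (hgt t hlt).le
  have hφge : ∀ t, q ≤ φ t := fun t => by
    rcases lt_or_ge t τ with ht | ht
    · simp only [hφ, min_eq_left ht.le]
      exact (hgt t ht).le
    · simp only [hφ, min_eq_right ht, huτ, le_refl]
  -- At rest the detection rate is `λ x q Y`, which is `c Y` by the choice of the cutoff.
  set η : ℝ → ℝ := fun t => if t < τ then k * u t else M.c * Y with hη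
  have hηm : Measurable η :=
    Measurable.ite measurableSet_Iio (huc.measurable.const_mul k) measurable_const
  have hcY : 0 < M.c * Y := mul_pos hc hY0
  have hcYc : M.c * Y ≤ M.c := mul_le_of_le_one_right hc.le hY1.le
  have hηlo : ∀ t, M.c * Y ≤ η t := fun t => by
    simp only [hη]
    split_ifs with ht
    · rw [← hxq] at hcYc
      exact hcYc.trans (mul_le_mul_of_nonneg_left (hgt t ht).le hk.le) |>.trans' (by rw [hxq])
    · exact le_rfl
  have hηhi : ∀ t, η t ≤ k * M.hiRoot k := fun t => by
    simp only [hη]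
    split_ifs with ht
    · exact mul_le_mul_of_nonneg_left (hle2 t) hk.le
    · refine hcYc.trans (hxq.symm.le.trans (mul_le_mul_of_nonneg_left ?_ hk.le))
      linarith [(M.one_mem_Ioo_roots hk).2]
  have hηint : ∀ a b, IntervalIntegrable η volume a b := fun a b => by
    rw [intervalIntegrable_iff]
    refine Measure.integrableOn_of_bounded (M := k * M.hiRoot k) (by simp)
      hηm.aestronglyMeasurable (Filter.Eventually.of_forall fun t => ?_)
    rw [Real.norm_of_nonneg (hcY.le.trans (hηlo t))]
    exact hηhi t
  set H : ℝ → ℝ := fun t => ∫ s in (0 : ℝ)..t, η s with hH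
  have hHsub : ∀ a b, H b - H a = ∫ s in a..b, η s := fun a b =>
    intervalIntegral.integral_interval_sub_left (hηint _ _) (hηint _ _)
  have hreg : IsRegeneration M x (cutoffPolicy q Y) φ η H (M.c * Y) (k * M.hiRoot k) := by
    refine ⟨hpath, hηint, fun t _ => ?_, fun t => rfl, ⟨by simp [hH], hcY, fun a b hab => ?_,
      fun a b hab => ?_⟩⟩
    · rw [Model.detectionRate]
      rcases lt_or_ge t τ with ht | ht
      · simp only [hφ, hη, min_eq_left ht.le, if_pos ht]
        rw [cutoffPolicy_of_gt (hgt t ht), hkdef]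
        ring
      · simp only [hφ, hη, min_eq_right ht, if_neg (not_lt.2 ht), huτ]
        rw [cutoffPolicy_self, ← hxq, hkdef]
        ring
    · rw [hHsub]
      have := intervalIntegral.integral_mono_on (μ := volume) hab intervalIntegrable_const
        (hηint a b) fun t _ => hηlo t
      rw [intervalIntegral.integral_const, smul_eq_mul] at this
      linarith
    · rw [hHsub]
      have := intervalIntegral.integral_mono_on (μ := volume) hab (hηint a b)
        intervalIntegrable_const fun t _ => hηhi t
      rw [intervalIntegral.integral_const, smul_eq_mul] at this
      linarith
  refine ⟨_, hreg.isStationary hadm hφm hτ.le (by simp only [hφ, min_self, huτ])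
    fun t _ => hφge t, ?_⟩
  rw [hreg.integral_conditionalOnHigh hx.1 hφm (monotone_cutoffPolicy hY).measurable, ← hkdef]
  -- the cumulative detection rate before and after the belief reaches `q`
  set L : ℝ → ℝ := fun t => ∫ s in (0 : ℝ)..t, k * u s with hL
  have hku : Continuous fun t => k * u t := continuous_const.mul huc
  have hLd : ∀ t, HasDerivAt L (k * u t) t := fun t =>
    intervalIntegral.integral_hasDerivAt_right (hku.intervalIntegrable _ _)
      (hku.stronglyMeasurableAtFilter _ _) hku.continuousAt
  have hLc : Continuous L := continuous_iff_continuousAt.2 fun t => (hLd t).continuousAt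
  have hHL : ∀ t, 0 ≤ t → t ≤ τ → H t = L t := fun t ht htτ => by
    simp only [hH, hL]
    rw [intervalIntegral.integral_of_le ht, intervalIntegral.integral_of_le ht,
      integral_Ioc_eq_integral_Ioo, integral_Ioc_eq_integral_Ioo]
    exact setIntegral_congr_fun measurableSet_Ioo fun a ha => if_pos (ha.2.trans_le htτ)
  have hLτ : Real.exp (-L τ) = s := by
    rw [← hsurv]
    simp only [hL, intervalIntegral.integral_const_mul]
  have hL0 : L 0 = 0 := by simp [hL]
  have hHτ : ∀ t, τ < t → Real.exp (-H t) = s * Real.exp (-(M.c * Y) * (t - τ)) := by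
    intro t ht
    have h1 : H t - H τ = M.c * Y * (t - τ) := by
      rw [hHsub, intervalIntegral.integral_of_le ht.le,
        setIntegral_congr_fun (g := fun _ => M.c * Y) measurableSet_Ioc
          fun a ha => if_neg (not_lt.2 ha.1.le), ← intervalIntegral.integral_of_le ht.le,
        intervalIntegral.integral_const, smul_eq_mul, mul_comm]
    rw [← hLτ, ← hHL τ hτ.le le_rfl, ← Real.exp_add]
    congr 1
    linarith
  obtain ⟨-, hm⟩ := integral_Ioi_eq_add_of_exp (f := fun t => Real.exp (-H t))
    (g := fun t => Real.exp (-L t)) hτ.le hcY (by fun_prop)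
    (fun t ht => by simp only [hHL t ht.1.le ht.2.le]) hHτ
  obtain ⟨-, hd⟩ := integral_Ioi_eq_add_of_exp (f := fun t => Real.exp (-H t) * η t)
    (g := fun t => Real.exp (-L t) * (k * u t)) (C := s * (M.c * Y)) hτ.le hcY (by fun_prop)
    (fun t ht => by simp only [hHL t ht.1.le ht.2.le, hη, if_pos ht.2])
    (fun t ht => by
      simp only [hHτ t ht, hη, if_neg (not_lt.2 ht.le)]
      ring)
  rw [hm, hd]
  have hexpd : ∀ t, HasDerivAt (fun t => Real.exp (-L t)) (-(k * u t * Real.exp (-L t))) t :=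
    fun t => (hLd t).neg.exp.congr_deriv (by simp only [Pi.neg_apply]; ring)
  have hI1 : ∫ t in (0 : ℝ)..τ, Real.exp (-L t) * (k * u t) = 1 - s := by
    have h1 : ∀ t, HasDerivAt (fun t => -Real.exp (-L t)) (Real.exp (-L t) * (k * u t)) t :=
      fun t => (hexpd t).neg.congr_deriv (by ring)
    have hcont : Continuous fun t => Real.exp (-L t) * (k * u t) := by fun_prop
    rw [intervalIntegral.integral_eq_sub_of_hasDerivAt (fun t _ => h1 t)
      (hcont.intervalIntegrable _ _), hLτ, hL0]
    simp
    ring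
  -- This computes `A` without integrating the explicit solution: `exp (-L) (1 - u)` is the
  -- unnormalized probability of the low state, and in its derivative the quadratic terms of the
  -- Riccati equation cancel.
  have hI2 : ∫ t in (0 : ℝ)..τ, ((M.rhoH + M.rhoL) * M.pi0 * Real.exp (-L t) -
      (M.rhoH + M.rhoL) / k * (Real.exp (-L t) * (k * u t))) = -(s * (1 - q)) := by
    have h1 : ∀ t, HasDerivAt (fun t => -(Real.exp (-L t) * (1 - u t)))
        ((M.rhoH + M.rhoL) * M.pi0 * Real.exp (-L t) -
          (M.rhoH + M.rhoL) / k * (Real.exp (-L t) * (k * u t))) t := fun t => by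
      refine (((hexpd t).mul ((hud t).const_sub 1)).neg).congr_deriv ?_
      rw [← M.isRoots hk (u t)]
      field_simp
      ring
    have hcont : Continuous fun t => (M.rhoH + M.rhoL) * M.pi0 * Real.exp (-L t) -
      (M.rhoH + M.rhoL) / k * (Real.exp (-L t) * (k * u t)) := by fun_prop
    rw [intervalIntegral.integral_eq_sub_of_hasDerivAt (fun t _ => h1 t)
      (hcont.intervalIntegrable _ _), hLτ, huτ, hu0]
    simp
  have hc1 : Continuous fun t => (M.rhoH + M.rhoL) * M.pi0 * Real.exp (-L t) := by fun_prop
  have hc2 : Continuous fun t => (M.rhoH + M.rhoL) / k * (Real.exp (-L t) * (k * u t)) := by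
    fun_prop
  rw [intervalIntegral.integral_sub (hc1.intervalIntegrable _ _) (hc2.intervalIntegrable _ _), intervalIntegral.integral_const_mul,
    intervalIntegral.integral_const_mul, hI1] at hI2
  rw [hI1]
  set A := ∫ t in (0 : ℝ)..τ, Real.exp (-L t) with hA
  have hspos : 0 < s := hLτ ▸ Real.exp_pos _
  have hApos : 0 ≤ A := intervalIntegral.integral_nonneg hτ.le fun t _ => (Real.exp_pos _).le
  have hmpos : 0 < A + s / (M.c * Y) := by positivity
  -- The numerator collapses to `(1 - s) + s = 1`: a detection occurs eventually.
  rw [mul_div_assoc, div_self hcY.ne', mul_one, sub_add_cancel]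
  have hkey : (A + s / (M.c * Y)) * (k * M.pi0) * Y = Y + s * (1 - Y) := by
    have h1 : k * (M.rhoH + M.rhoL) * M.pi0 * A =
        (M.rhoH + M.rhoL) * (1 - s) - k * s * (1 - q) := by
      have : (M.rhoH + M.rhoL) * M.pi0 * A =
          (M.rhoH + M.rhoL) / k * (1 - s) - s * (1 - q) := by linarith
      calc k * (M.rhoH + M.rhoL) * M.pi0 * A = k * ((M.rhoH + M.rhoL) * M.pi0 * A) := by ring
        _ = _ := by
          rw [this]
          field_simp
    have h2 : (M.rhoH + M.rhoL) * ((A + s / (M.c * Y)) * (k * M.pi0) * Y) =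
        (M.rhoH + M.rhoL) * (Y + s * (1 - Y)) := by
      have h3 : (A + s / (M.c * Y)) * (k * M.pi0) * Y =
          (k * M.pi0 * A) * Y + s * k * M.pi0 / M.c := by
        field_simp
      rw [h3]
      have h4 : k * (1 - q) * Y * M.c = k * ((M.rhoH + M.rhoL) * (M.pi0 - q)) := by
        rw [← hYq]
        ring
      have h5 : k * (1 - q) * Y = (M.rhoH + M.rhoL) * (k * M.pi0 / M.c - 1) := by
        have : k * M.pi0 / M.c - 1 = k * (M.pi0 - q) / M.c := by
          rw [← hxq]
          field_simp
        rw [this, ← mul_div_assoc, eq_div_iff hc.ne', h4]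
        ring
      linear_combination Y * h1 - s * h5
    exact mul_left_cancel₀ hR.ne' h2
  rw [← hkey]
  have := hmpos.ne'
  field_simp

/-! ### Existence of greedy equilibria -/

lemma Model.exists_isGPEquilibrium_of_le (h : M.lam * M.pi0 ≤ M.c) :
    ∃ x y, M.IsGPEquilibrium x y := by
  have hl := M.lam_pos
  have hx : (1 : ℝ) ∈ Ioc (0 : ℝ) 1 := ⟨one_pos, le_rfl⟩
  have hx' : (1 : ℝ) ∈ Icc (0 : ℝ) 1 := ⟨zero_le_one, le_rfl⟩
  have hxq : M.lam * 1 * (M.c / M.lam) = M.c := by field_simp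
  have hpi : M.pi0 ≤ M.c / M.lam := by rwa [le_div_iff₀' hl]
  have hY : (0 : ℝ) ∈ Icc (0 : ℝ) 1 := ⟨le_rfl, zero_le_one⟩
  have hadm := admissible_cutoffPolicy_of_pi0_le (M := M) hx hpi
  have hopt : ∀ p ∈ Icc (0 : ℝ) 1, M.IsMyopicOptimum 1 p (cutoffPolicy (M.c / M.lam) 0 p) :=
    fun p _ => isMyopicOptimum_cutoffPolicy one_pos hxq hY p
  refine ⟨1, _, hadm, hopt, Measure.dirac M.pi0,
    isStationary_dirac_pi0 hx' hadm hopt (by rwa [mul_one]), ?_⟩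
  have h0 : cutoffPolicy (M.c / M.lam) 0 M.pi0 = 0 := by
    rcases hpi.eq_or_lt with heq | hlt
    · rw [heq, cutoffPolicy_self]
    · exact cutoffPolicy_of_lt hlt
  have hint : ∫ p, cutoffPolicy (M.c / M.lam) 0 p ∂(M.conditionalOnHigh (Measure.dirac M.pi0)) =
      0 := by
    refine integral_eq_zero_of_ae ((withDensity_absolutelyContinuous _ _).ae_le ?_)
    have hms : MeasurableSet {p | cutoffPolicy (M.c / M.lam) 0 p = 0} :=
      (monotone_cutoffPolicy hY).measurable (measurableSet_singleton 0)
    exact (ae_dirac_iff hms).2 h0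
  rw [hint]
  exact ⟨hx', fun h => absurd h (not_lt.2 M.ybar_pos.le), fun _ => rfl⟩

/-- The enforcement level that keeps the belief at the cutoff `q`. -/
noncomputable def Model.holdingLevel (M : Model) (q : ℝ) : ℝ :=
  (M.rhoH + M.rhoL) * (M.pi0 - q) / ((1 - q) * M.c)

/-- A function of the cutoff with the sign of the difference between the expected enforcement
conditional on the high state and the deterrence threshold. -/
noncomputable def Model.enforcementGap (M : Model) (q : ℝ) : ℝ :=
  min (M.holdingLevel q) 1 * (1 - M.ybar) -
    M.ybar * M.descentSurvival (M.c / q) q * (1 - min (M.holdingLevel q) 1)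

lemma Model.loRoot_lt_hiRoot (M : Model) {k : ℝ} (hk : 0 < k) : M.loRoot k < M.hiRoot k := by
  have := M.one_mem_Ioo_roots hk
  linarith

lemma Model.continuousOn_descentSurvival (M : Model) :
    ContinuousOn (fun q => M.descentSurvival (M.c / q) q) (Ioo 0 1) := by
  have hk : ∀ q ∈ Ioo (0 : ℝ) 1, 0 < M.c / q := fun q hq => div_pos M.c_pos hq.1
  have hkc : ContinuousOn (fun q => M.c / q) (Ioo 0 1) :=
    continuousOn_const.div continuousOn_id fun q hq => hq.1.ne'
  have hD : ContinuousOn (fun q => M.rootDisc (M.c / q)) (Ioo 0 1) := by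
    unfold Model.rootDisc
    exact Real.continuous_sqrt.comp_continuousOn (by fun_prop)
  have hne : ∀ q ∈ Ioo (0 : ℝ) 1, 2 * (M.c / q) ≠ 0 := fun q hq => by
    have := hk q hq
    positivity
  have hlo : ContinuousOn (fun q => M.loRoot (M.c / q)) (Ioo 0 1) := by
    unfold Model.loRoot
    exact ((hkc.add continuousOn_const).sub hD).div (continuousOn_const.mul hkc) hne
  have hhi : ContinuousOn (fun q => M.hiRoot (M.c / q)) (Ioo 0 1) := by
    unfold Model.hiRoot
    exact ((hkc.add continuousOn_const).add hD).div (continuousOn_const.mul hkc) hne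
  have h1 : ∀ q ∈ Ioo (0 : ℝ) 1, M.hiRoot (M.c / q) - q ≠ 0 := fun q hq => by
    have := (M.one_mem_Ioo_roots (hk q hq)).2
    exact (by linarith [hq.2] : 0 < M.hiRoot (M.c / q) - q).ne'
  have h2 : ∀ q ∈ Ioo (0 : ℝ) 1, 1 - M.loRoot (M.c / q) ≠ 0 := fun q hq =>
    (sub_pos.2 (M.one_mem_Ioo_roots (hk q hq)).1).ne'
  have h3 : ∀ q ∈ Ioo (0 : ℝ) 1, 0 < M.hiRoot (M.c / q) - M.loRoot (M.c / q) := fun q hq =>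
    sub_pos.2 (M.loRoot_lt_hiRoot (hk q hq))
  unfold Model.descentSurvival
  -- The base need not be positive for every `q` in `(0, 1)`, so continuity of the power rests on
  -- the positive exponent.
  refine ContinuousOn.mul (ContinuousOn.rpow ?_ ?_ fun q hq => Or.inr ?_) ?_
  · exact ((continuousOn_id.sub hlo).mul (hhi.sub continuousOn_const)).div
      ((hhi.sub continuousOn_id).mul (continuousOn_const.sub hlo))
      fun q hq => mul_ne_zero (h1 q hq) (h2 q hq)
  · exact hlo.div (hhi.sub hlo) fun q hq => (h3 q hq).ne'
  · exact div_pos (M.loRoot_pos (hk q hq)) (h3 q hq)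
  · exact (hhi.sub continuousOn_const).div (hhi.sub continuousOn_id) h1

lemma Model.continuousOn_enforcementGap (M : Model) : ContinuousOn M.enforcementGap (Ioo 0 1) := by
  have hY : ContinuousOn M.holdingLevel (Ioo 0 1) := by
    unfold Model.holdingLevel
    refine ContinuousOn.div (by fun_prop) (by fun_prop) fun q hq => ?_
    exact (mul_pos (sub_pos.2 hq.2) M.c_pos).ne'
  have hm : ContinuousOn (fun q => min (M.holdingLevel q) 1) (Ioo 0 1) :=
    hY.inf continuousOn_const
  unfold Model.enforcementGap
  exact (hm.mul continuousOn_const).sub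
    ((continuousOn_const.mul M.continuousOn_descentSurvival).mul (continuousOn_const.sub hm))

lemma Model.descentSurvival_pos (M : Model) {k q : ℝ} (hk : 0 < k) (hq : M.loRoot k < q)
    (hq1 : q < 1) : 0 < M.descentSurvival k q := by
  obtain ⟨h1, h2⟩ := M.one_mem_Ioo_roots hk
  have h3 : 0 < q - M.loRoot k := sub_pos.2 hq
  have h4 : 0 < M.hiRoot k - 1 := sub_pos.2 h2
  have h5 : 0 < 1 - M.loRoot k := sub_pos.2 h1
  have h6 : 0 < M.hiRoot k - q := by linarith
  unfold Model.descentSurvival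
  positivity

lemma Model.enforcementGap_pi0_neg (M : Model) : M.enforcementGap M.pi0 < 0 := by
  have hk := div_pos M.c_pos M.pi0_pos
  have h1 : M.loRoot (M.c / M.pi0) < M.pi0 := (M.mem_Ioo_roots hk (by
    rw [sub_self, mul_zero, zero_sub, neg_lt_zero]
    exact mul_pos (mul_pos M.pi0_pos (sub_pos.2 M.pi0_lt_one)) hk)).1
  have h2 := mul_pos M.ybar_pos (M.descentSurvival_pos hk h1 M.pi0_lt_one)
  have h3 : M.holdingLevel M.pi0 = 0 := by simp [Model.holdingLevel]
  rw [Model.enforcementGap, h3, min_eq_left zero_le_one]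
  linarith

lemma Model.exists_isGPEquilibrium_of_lt (h : M.c < M.lam * M.pi0) :
    ∃ x y, M.IsGPEquilibrium x y := by
  have hl := M.lam_pos
  have hc := M.c_pos
  have hR := M.switch_pos
  have hlo : M.c / M.lam < M.pi0 := by rwa [div_lt_iff₀' hl]
  have hlo0 : 0 < M.c / M.lam := div_pos hc hl
  -- The left end `c / λ` corresponds to `x = 1`. If enforcement there does not exceed the
  -- threshold, this corner is an equilibrium; otherwise the gap changes sign before `π₀`.
  obtain ⟨q, hlq, hq, hgap⟩ : ∃ q, M.c / M.lam ≤ q ∧ q < M.pi0 ∧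
      (M.enforcementGap q = 0 ∨ M.enforcementGap q ≤ 0 ∧ q = M.c / M.lam) := by
    rcases le_or_gt (M.enforcementGap (M.c / M.lam)) 0 with h0 | h0
    · exact ⟨_, le_rfl, hlo, Or.inr ⟨h0, rfl⟩⟩
    · obtain ⟨q, hq, hq0⟩ := intermediate_value_Icc' hlo.le
        (M.continuousOn_enforcementGap.mono fun q hq =>
          ⟨hlo0.trans_le hq.1, hq.2.trans_lt M.pi0_lt_one⟩) ⟨M.enforcementGap_pi0_neg.le, h0.le⟩
      refine ⟨q, hq.1, hq.2.lt_of_ne fun heq => ?_, Or.inl hq0⟩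
      rw [heq] at hq0
      exact absurd hq0 M.enforcementGap_pi0_neg.ne
  have hq0 : 0 < q := hlo0.trans_le hlq
  have hq1 : q < 1 := hq.trans M.pi0_lt_one
  have hgap0 : M.enforcementGap q ≤ 0 := hgap.elim (fun h => h.le) fun h => h.1
  set Y := M.holdingLevel q with hYdef
  have hY0 : 0 < Y := div_pos (mul_pos hR (sub_pos.2 hq)) (mul_pos (sub_pos.2 hq1) hc)
  -- Were `Y ≥ 1`, the truncated gap would be `1 - ybar > 0`. So the truncation, needed to define
  -- the gap on the whole interval, is inactive at the chosen `q`.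
  have hY1 : Y < 1 := by
    by_contra! hcon
    rw [Model.enforcementGap, min_eq_right hcon] at hgap0
    linarith [M.ybar_lt_one]
  have hYq : M.c * Y * (1 - q) = (M.rhoH + M.rhoL) * (M.pi0 - q) := by
    have : 1 - q ≠ 0 := (sub_pos.2 hq1).ne'
    rw [hYdef, Model.holdingLevel]
    field_simp
  set x := M.c / (M.lam * q) with hx
  have hxm : x ∈ Ioc (0 : ℝ) 1 := by
    refine ⟨by positivity, (div_le_one (by positivity)).2 ?_⟩
    rwa [div_le_iff₀' hl] at hlq
  have hxq : M.lam * x * q = M.c := by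
    rw [hx]
    field_simp
  have hk : M.lam * x = M.c / q := by
    rw [hx]
    field_simp
  have hY : Y ∈ Icc (0 : ℝ) 1 := ⟨hY0.le, hY1.le⟩
  obtain ⟨hadm, Φ, hΦ, hE⟩ := exists_isStationary_cutoffPolicy hxm hq0 hq hxq hY0 hY1 hYq
  refine ⟨x, cutoffPolicy q Y, hadm,
    fun p _ => isMyopicOptimum_cutoffPolicy hxm.1 hxq hY p, Φ, hΦ, ⟨hxm.1.le, hxm.2⟩, ?_⟩
  set E := ∫ p, cutoffPolicy q Y p ∂(M.conditionalOnHigh Φ)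
  have hlor : M.loRoot (M.c / q) < q := (M.mem_Ioo_roots (div_pos hc hq0) (by
    have : (M.rhoH + M.rhoL) * (M.pi0 - q) - q * (1 - q) * (M.c / q) =
        -(M.c * (1 - q) * (1 - Y)) := by
      rw [← hYq]
      field_simp
      ring
    rw [this, neg_lt_zero]
    exact mul_pos (mul_pos hc (sub_pos.2 hq1)) (sub_pos.2 hY1))).1
  have hs := M.descentSurvival_pos (div_pos hc hq0) hlor hq1
  rw [hk] at hE
  set s := M.descentSurvival (M.c / q) q with hsdef
  have hden : 0 < Y + s * (1 - Y) := add_pos hY0 (mul_pos hs (sub_pos.2 hY1))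
  have hG : M.enforcementGap q = (E - M.ybar) * (Y + s * (1 - Y)) := by
    rw [Model.enforcementGap, ← hYdef, ← hsdef, min_eq_left hY1.le]
    linear_combination -hE
  rw [hG] at hgap
  rcases hgap with h0 | ⟨h0, hqeq⟩
  · have hEy : E = M.ybar := sub_eq_zero.1 ((mul_eq_zero.1 h0).resolve_right hden.ne')
    exact ⟨fun h => absurd h (hEy ▸ lt_irrefl _), fun h => absurd h (hEy ▸ lt_irrefl _)⟩
  · have hEy : E ≤ M.ybar := by
      by_contra! hcon
      exact absurd h0 (not_le.2 (mul_pos (sub_pos.2 hcon) hden))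
    refine ⟨fun h => absurd h (not_lt.2 hEy), fun _ => ?_⟩
    rw [hx, hqeq]
    field_simp

end PredictiveEnforcement

theorem corollary1 (M : PredictiveEnforcement.Model) :
    (∃ (x y : ℝ), M.IsNPEquilibrium x y) ∧
    (∃ (x : ℝ) (y : ℝ → ℝ), M.IsGPEquilibrium x y) ∧
    ∀ (xNP yNP xGP : ℝ) (yGP : ℝ → ℝ),
      M.IsNPEquilibrium xNP yNP → M.IsGPEquilibrium xGP yGP →
      ∀ p ∈ M.longRunPriors xGP,
        M.expectedLoss xGP yGP p = M.lossNP xNP yNP := by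
  refine ⟨M.exists_isNPEquilibrium, ?_, fun xNP yNP xGP yGP hNP hGP p hp => ?_⟩
  · rcases le_or_gt (M.lam * M.pi0) M.c with h | h
    · exact M.exists_isGPEquilibrium_of_le h
    · exact M.exists_isGPEquilibrium_of_lt h
  · rw [hGP.expectedLoss_eq hp, hNP.lossNP_eq]
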